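/- **Conventions.** Let $C$ be a triangulated category. A *weight structure* $w$ on $C$ is a pair of retraction-closed classes $C_{w\le 0}, C_{w\ge 0}\subset \mathrm{Obj}\,C$ such that $C_{w\le 0}\subset C_{w\le 0}[1]$, $C_{w\ge 0}[1]\subset C_{w\ge 0}$, there are no non-zero morphisms from objects of $C_{w\le 0}$ to objects of $C_{w\ge 0}[1]$, and every object $M$ sits in a distinguished triangle $L\to M\to R\to L[1]$ with $L\in C_{w\le 0}$, $R\in C_{w\ge 0}[1]$. Put $C_{w\le i}=C_{w\le 0}[i]$, $C_{w\ge i}=C_{w\ge 0}[i]$, $C_{w=0}=C_{w\le 0}\cap C_{w\ge 0}$, $C_{w=i}=C_{w=0}[i]$; the *heart* $Hw$ is the full subcategory of $C$ with objects $C_{w=0}$. The weight structure is *bounded* if every object lies in some $C_{w\le i}$ and in some $C_{w\ge j}$. An exact functor is *weight-exact* if it respects the classes $(-)_{w\le 0}$ and $(-)_{w\ge 0}$. A *weight complex* $t(M)$ of $M\in C$ is the complex over $Hw$ associated with a weight Postnikov tower of $M$: choose morphisms $w_{\le i}M\to M$ ($i\in\mathbb Z$) with $w_{\le i}M\in C_{w\le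 i}$ and cone in $C_{w\ge i+1}$, compatible morphisms $w_{\le i-1}M\to w_{\le i}M$, and cones $M_i$ of the latter; then $t(M)^n=M_{-n}[n]$, with the differential induced by $M_{i}\to (w_{\le i-1}M)[1]\to M_{i-1}[1]$. (It is well defined up to homotopy equivalence.) For an additive category $A$, $K_0^{\mathrm{add}}(A)$ is the abelian group generated by isomorphism classes of objects with relations $[Y]=[X]+[Z]$ for $Y\cong X\oplus Z$; for a triangulated category $T$, $K_0^{\mathrm{tr}}(T)$ is generated by isomorphism classes of objects with relations $[Y]=[X]+[Z]$ for distinguished triangles $X\to Y\to Z\to X[1]$. **Theorem.** Let $w$ be a weight structure on $C$, let $C'\subset C$ be a full triangulated subcategory, $B\subset Hw$ a full additive subcategory, $N$ an object of $C'$, and $F:B\to A$ an additive functor into an additive category. Assume that for every object $M$ of $C'$ the complex $t(M)$ is homotopy equivalent (over $Hw$) to a complex $(M^i)$ over $B$ with $F(M^i)=0$ for almost all $i\in\mathbb Z$. If $A$ is abelian, write $H^F(M)$ for the zeroth homology of the complex $(F(M^i))$, where $(M^i)$ is any $B$-complex homotopy equivalent to $t(M)$, and $H^F_j(M)=H^F(M[-j])$.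 **I.1.** The correspondence $M\mapsto\sum_{i\in\mathbb Z}(-1)^i[F(M^i)]$, where $(M^i)$ is any $B$-complex as in the assumption, gives a well-defined homomorphism $F_{K_0}:K_0^{\mathrm{tr}}(C')\to K_0^{\mathrm{add}}(A)$. **I.2.** Assume that $B=Hw\subset C'$, that $A$ is abelian, and that there is a $C'$-morphism $h$ either from $N'$ to $N$ or from $N$ to $N'$, where $N'\in C_{w=0}$, such that $F_{K_0}([\mathrm{Cone}(h)])=0$. Then $F_{K_0}([N])=[F(N')]$. If moreover $H^F_j(\mathrm{Cone}(h))=0$ for $j=0,1$, then $F_{K_0}([N])=[H^F(N)]$. **I.3.** Assume that $A$ is abelian and semi-simple (all short exact sequences in $A$ split). Then $H^F_i(N)=0$ for almost all $i$, and $F_{K_0}([N])=\sum_{i\in\mathbb Z}(-1)^i[H^F_i(N)]$. **II.** Now let $C'=C$ and assume that $B$ strongly generates $C$, i.e. the smallest strictly full triangulated subcategory of $C$ containing $B$ is $C$. **II.1.** The assumption of the theorem holds for $\mathrm{id}_B$ (with $C'=C$), and the corresponding homomorphism $\mathrm{id}_{B,K_0}:K_0^{\mathrm{tr}}(C)\to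 K_0^{\mathrm{add}}(B)$ is an isomorphism. The same is true with $B$ replaced by $Hw$; in fact $\mathrm{id}_{Hw,K_0}: K_0^{\mathrm{tr}}(C)\to K_0^{\mathrm{add}}(Hw)$ is defined and is an isomorphism whenever $w$ is bounded. **II.2.** Assume that $B=Hw$, $A$ is abelian, and $F\cong F'\circ HG$, where $HG:Hw\to Hv$ is the restriction to hearts of a weight-exact functor $G:(C,w)\to(D,v)$ and $F':Hv\to A$ is an additive functor, and that $G(N)\in D_{v=j}$ for some $j\in\mathbb Z$. Then $F_{K_0}([N])=(-1)^j[H^F_j(N)]$. -/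

import Mathlib

open CategoryTheory CategoryTheory.Category CategoryTheory.Limits CategoryTheory.Pretriangulated

universe v u v₁ u₁ v₂ u₂ v₃ u₃

noncomputable section

namespace Weights

/-! ### Grothendieck groups -/

section GrothendieckGroups

/-- The split Grothendieck group of an additive category: generated by the isomorphism classes of
objects, with a relation `[Y] = [X] + [Z]` whenever `Y ≅ X ⊞ Z`. -/
def K0Add (A : Type u) [Category.{v} A] [Preadditive A] [HasBinaryBiproducts A] : Type u :=
  FreeAbelianGroup (Quotient (isIsomorphicSetoid A)) ⧸
    AddSubgroup.closure
      {r : FreeAbelianGroup (Quotient (isIsomorphicSetoid A)) |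
        ∃ X Y Z : A, Nonempty (Y ≅ X ⊞ Z) ∧
          r = FreeAbelianGroup.of (Quotient.mk _ Y) -
            (FreeAbelianGroup.of (Quotient.mk _ X) + FreeAbelianGroup.of (Quotient.mk _ Z))}

instance (A : Type u) [Category.{v} A] [Preadditive A] [HasBinaryBiproducts A] :
    AddCommGroup (K0Add A) :=
  inferInstanceAs (AddCommGroup (_ ⧸ _))

/-- The class `[X]` of an object in the split Grothendieck group. -/
def K0Add.mk {A : Type u} [Category.{v} A] [Preadditive A] [HasBinaryBiproducts A] (X : A) :
    K0Add A :=
  QuotientAddGroup.mk (FreeAbelianGroup.of (Quotient.mk (isIsomorphicSetoid A) X))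

/-- The Grothendieck group of a triangulated category: generated by the isomorphism classes of
objects, with a relation `[Y] = [X] + [Z]` for every distinguished triangle
`X ⟶ Y ⟶ Z ⟶ X⟦1⟧`. -/
def K0Tr (T : Type u) [Category.{v} T] [HasZeroObject T] [HasShift T ℤ] [Preadditive T]
    [∀ n : ℤ, (shiftFunctor T n).Additive] [Pretriangulated T] : Type u :=
  FreeAbelianGroup (Quotient (isIsomorphicSetoid T)) ⧸
    AddSubgroup.closure
      {r : FreeAbelianGroup (Quotient (isIsomorphicSetoid T)) |
        ∃ (X Y Z : T) (f : X ⟶ Y) (g : Y ⟶ Z) (h : Z ⟶ X⟦(1 : ℤ)⟧),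
          Triangle.mk f g h ∈ distTriang T ∧
          r = FreeAbelianGroup.of (Quotient.mk _ Y) -
            (FreeAbelianGroup.of (Quotient.mk _ X) + FreeAbelianGroup.of (Quotient.mk _ Z))}

variable {T : Type u} [Category.{v} T] [HasZeroObject T] [HasShift T ℤ] [Preadditive T]
  [∀ n : ℤ, (shiftFunctor T n).Additive] [Pretriangulated T]

instance : AddCommGroup (K0Tr T) :=
  inferInstanceAs (AddCommGroup (_ ⧸ _))

/-- The class `[X]` of an object in the Grothendieck group of a triangulated category. -/
def K0Tr.mk (X : T) : K0Tr T :=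
  QuotientAddGroup.mk (FreeAbelianGroup.of (Quotient.mk (isIsomorphicSetoid T) X))

end GrothendieckGroups

/-- An abelian category is semi-simple if all of its short exact sequences split. -/
def IsSemisimpleAbelian (A : Type u) [Category.{v} A] [Abelian A] : Prop :=
  ∀ S : ShortComplex A, S.ShortExact → Nonempty S.Splitting

section Triangulated

variable {C : Type u} [Category.{v} C] [HasZeroObject C] [HasShift C ℤ] [Preadditive C]
  [∀ n : ℤ, (shiftFunctor C n).Additive] [Pretriangulated C]

/-- `B` strongly generates `C`: the smallest strictly full triangulated subcategory of `C` that
contains `B` is `C` itself. -/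
def StronglyGenerates (B : ObjectProperty C) : Prop :=
  ∀ P : ObjectProperty C, P.IsTriangulated → P.IsClosedUnderIsomorphisms → B ≤ P → ∀ X : C, P X

variable (C) in
/-- A weight structure (in the homological convention): `le` is the class `C_{w ≤ 0}` and `ge` is
the class `C_{w ≥ 0}`. An object `X` lies in the shifted class `P[i]` iff `P (X⟦-i⟧)`. -/
structure WeightStructure where
  /-- the class `C_{w ≤ 0}` -/
  le : ObjectProperty C
  /-- the class `C_{w ≥ 0}` -/
  ge : ObjectProperty C
  le_retracts : le.IsStableUnderRetracts
  ge_retracts : ge.IsStableUnderRetracts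
  /-- `C_{w ≤ 0} ⊆ C_{w ≤ 0}[1]` -/
  le_shift : ∀ X : C, le X → le (X⟦(-1 : ℤ)⟧)
  /-- `C_{w ≥ 0}[1] ⊆ C_{w ≥ 0}` -/
  ge_shift : ∀ X : C, ge X → ge (X⟦(1 : ℤ)⟧)
  /-- `C_{w ≤ 0} ⊥ C_{w ≥ 0}[1]` -/
  orthogonal : ∀ (X Y : C), le X → ge Y → ∀ f : X ⟶ Y⟦(1 : ℤ)⟧, f = 0
  /-- existence of weight decompositions -/
  exists_decomposition : ∀ M : C, ∃ (L R : C) (f : L ⟶ M) (g : M ⟶ R) (h : R ⟶ L⟦(1 : ℤ)⟧),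
    Triangle.mk f g h ∈ distTriang C ∧ le L ∧ ge (R⟦(-1 : ℤ)⟧)

namespace WeightStructure

variable (w : WeightStructure C)

/-- The class `C_{w ≤ i} = C_{w ≤ 0}[i]`. -/
def IsLE (i : ℤ) (X : C) : Prop := w.le (X⟦-i⟧)

/-- The class `C_{w ≥ i} = C_{w ≥ 0}[i]`. -/
def IsGE (i : ℤ) (X : C) : Prop := w.ge (X⟦-i⟧)

/-- The (class of objects of the) heart: `C_{w = 0} = C_{w ≤ 0} ∩ C_{w ≥ 0}`. -/
def heart : ObjectProperty C := fun X => w.le X ∧ w.ge X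

/-- The class `C_{w = i} = C_{w = 0}[i]`. -/
def IsEQ (i : ℤ) (X : C) : Prop := w.heart (X⟦-i⟧)

/-- `w` is bounded: every object is bounded above and bounded below. -/
def IsBounded : Prop := ∀ X : C, (∃ i : ℤ, w.IsLE i X) ∧ ∃ i : ℤ, w.IsGE i X

/-- The heart as a full subcategory. -/
abbrev Heart : Type u := w.heart.FullSubcategory

/-! #### The heart is an additive category -/

lemma le_of_orthogonal (M : C) (hM : ∀ (Y : C), w.ge Y → ∀ f : M ⟶ Y⟦(1 : ℤ)⟧, f = 0) :
    w.le M := by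
  obtain ⟨L, R, f, g, h, hT, hL, hR⟩ := w.exists_decomposition M
  have hg : g = 0 := by
    have e : R ≅ (R⟦(-1 : ℤ)⟧)⟦(1 : ℤ)⟧ := ((shiftEquiv C (1 : ℤ)).counitIso.app R).symm
    have := hM _ hR (g ≫ e.hom)
    simpa using congrArg (· ≫ e.inv) this
  obtain ⟨s, hs⟩ := Triangle.coyoneda_exact₂ _ hT (𝟙 M) (by subst hg; exact comp_zero)
  exact w.le_retracts.of_retract ⟨s, f, hs.symm⟩ hL

lemma ge_of_orthogonal (M : C) (hM : ∀ (X : C), w.le X → ∀ f : X ⟶ M⟦(1 : ℤ)⟧, f = 0) :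
    w.ge M := by
  obtain ⟨L, R, f, g, h, hT, hL, hR⟩ := w.exists_decomposition (M⟦(1 : ℤ)⟧)
  have hf : f = 0 := hM _ hL f
  obtain ⟨s, hs⟩ := Triangle.yoneda_exact₂ _ hT (𝟙 (M⟦(1 : ℤ)⟧)) (by subst hf; exact zero_comp)
  have r : Retract (M⟦(1 : ℤ)⟧) R := ⟨g, s, hs.symm⟩
  have e : M ≅ (M⟦(1 : ℤ)⟧)⟦(-1 : ℤ)⟧ := (shiftEquiv C (1 : ℤ)).unitIso.app M
  exact w.ge_retracts.of_retract (e.retract.trans (r.map (shiftFunctor C (-1 : ℤ)))) hR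

lemma heart_biprod (X Y : C) (hX : w.heart X) (hY : w.heart Y) : w.heart (X ⊞ Y) := by
  constructor
  · refine w.le_of_orthogonal _ (fun Z hZ f => ?_)
    apply biprod.hom_ext'
    · simpa using w.orthogonal _ _ hX.1 hZ _
    · simpa using w.orthogonal _ _ hY.1 hZ _
  · refine w.ge_of_orthogonal _ (fun Z hZ f => ?_)
    have h₁ := w.orthogonal _ _ hZ hX.2 (f ≫ (shiftFunctor C (1 : ℤ)).map biprod.fst)
    have h₂ := w.orthogonal _ _ hZ hY.2 (f ≫ (shiftFunctor C (1 : ℤ)).map biprod.snd)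
    have : 𝟙 ((X ⊞ Y)⟦(1 : ℤ)⟧) = (shiftFunctor C (1 : ℤ)).map biprod.fst ≫
        (shiftFunctor C (1 : ℤ)).map biprod.inl +
        (shiftFunctor C (1 : ℤ)).map biprod.snd ≫ (shiftFunctor C (1 : ℤ)).map biprod.inr := by
      rw [← Functor.map_comp, ← Functor.map_comp, ← Functor.map_add, biprod.total,
        CategoryTheory.Functor.map_id]
    rw [← comp_id f, this, Preadditive.comp_add, ← assoc, ← assoc, h₁, h₂]
    simp

lemma heart_zero {Z : C} (hZ : IsZero Z) : w.heart Z :=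
  ⟨w.le_of_orthogonal _ (fun _ _ _ => hZ.eq_of_src _ _),
    w.ge_of_orthogonal _ (fun _ _ _ =>
      ((shiftFunctor C (1 : ℤ)).map_isZero hZ).eq_of_tgt _ _)⟩

instance : w.heart.IsClosedUnderIsomorphisms where
  of_iso e h := ⟨w.le_retracts.of_retract e.symm.retract h.1,
    w.ge_retracts.of_retract e.symm.retract h.2⟩

instance : w.heart.ContainsZero where
  exists_zero := by
    obtain ⟨Z, hZ⟩ := HasZeroObject.zero (C := C)
    exact ⟨Z, hZ, w.heart_zero hZ⟩

instance : w.heart.IsClosedUnderBinaryProducts where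
  limitsOfShape_le := by
    rintro X ⟨p⟩
    have hlim := (IsLimit.postcomposeHomEquiv (diagramIsoPair p.diag) _).symm p.isLimit
    let e := IsLimit.conePointUniqueUpToIso hlim (BinaryBiproduct.isLimit
      (p.diag.obj ⟨WalkingPair.left⟩) (p.diag.obj ⟨WalkingPair.right⟩))
    exact w.heart.prop_of_iso e.symm
      (w.heart_biprod _ _ (p.prop_diag_obj _) (p.prop_diag_obj _))

instance : HasBinaryBiproducts w.Heart :=
  HasBinaryBiproducts.of_hasBinaryProducts

instance : HasZeroObject w.Heart := by
  obtain ⟨Z, hZ⟩ := HasZeroObject.zero (C := C)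
  exact ⟨⟨Z, w.heart_zero hZ⟩, (IsZero.iff_id_eq_zero _).2 (by ext; exact hZ.eq_of_src _ _)⟩

/-! #### Weight complexes -/

/-- A weight Postnikov tower of `M`, indexed cohomologically: `obj n` is `w_{≤ -n} M`.
It consists of weight decompositions `w_{≤ -n} M ⟶ M ⟶ w_{≥ -n+1} M` of `M` for all integers `n`,
compatible connecting morphisms `w_{≤ -(n+1)} M ⟶ w_{≤ -n} M`, and cones `factor n` of these
connecting morphisms. -/
structure PostnikovTower (M : C) where
  obj : ℤ → C
  toObj : ∀ n : ℤ, obj n ⟶ M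
  isLE : ∀ n : ℤ, w.IsLE (-n) (obj n)
  isGE : ∀ n : ℤ, ∃ (R : C) (g : M ⟶ R) (h : R ⟶ (obj n)⟦(1 : ℤ)⟧),
    Triangle.mk (toObj n) g h ∈ distTriang C ∧ w.IsGE (-n + 1) R
  map : ∀ n : ℤ, obj (n + 1) ⟶ obj n
  comm : ∀ n : ℤ, map n ≫ toObj n = toObj (n + 1)
  factor : ℤ → C
  π : ∀ n : ℤ, obj n ⟶ factor n
  δ : ∀ n : ℤ, factor n ⟶ (obj (n + 1))⟦(1 : ℤ)⟧
  distinguished : ∀ n : ℤ, Triangle.mk (map n) (π n) (δ n) ∈ distTriang C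

/-- The `n`-th term `factor n⟦n⟧` of the complex associated with a Postnikov tower. -/
def PostnikovTower.X {w : WeightStructure C} {M : C} (T : w.PostnikovTower M) (n : ℤ) : C :=
  (T.factor n)⟦n⟧

/-- The differential of the complex associated with a Postnikov tower: the shift by `n` of the
composition `factor n ⟶ (obj (n + 1))⟦1⟧ ⟶ (factor (n + 1))⟦1⟧`. -/
def PostnikovTower.d {w : WeightStructure C} {M : C} (T : w.PostnikovTower M) (n : ℤ) :
    T.X n ⟶ T.X (n + 1) :=
  (T.δ n ≫ (T.π (n + 1))⟦(1 : ℤ)⟧')⟦n⟧' ≫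
    (shiftFunctorAdd' C 1 n (n + 1) (add_comm 1 n)).inv.app (T.factor (n + 1))

/-- `K` is a weight complex `t(M)` of `M`: it is a complex over the heart that is isomorphic to the
complex associated with some weight Postnikov tower of `M`. -/
def IsWeightComplex (M : C) (K : CochainComplex w.Heart ℤ) : Prop :=
  ∃ (T : w.PostnikovTower M) (e : ∀ n : ℤ, (K.X n).obj ≅ T.X n),
    ∀ n : ℤ, w.heart.ι.map (K.d n (n + 1)) ≫ (e (n + 1)).hom = (e n).hom ≫ T.d n

variable {B : ObjectProperty C} (hB : B ≤ w.heart)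

instance : (ObjectProperty.ιOfLE hB).Additive where

/-- The complex `X` over the full subcategory `B` of the heart is homotopy equivalent, as a complex
over the heart, to a weight complex of `M`. -/
def IsModel (M : C) (X : CochainComplex B.FullSubcategory ℤ) : Prop :=
  ∃ K : CochainComplex w.Heart ℤ, w.IsWeightComplex M K ∧
    Nonempty (HomotopyEquiv
      (((ObjectProperty.ιOfLE hB).mapHomologicalComplex (ComplexShape.up ℤ)).obj X) K)

/-- `F(X^i) = 0` for almost all `i`. -/
def FinitelySupported {A : Type u₂} [Category.{v₂} A] (F : B.FullSubcategory ⥤ A)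
    (X : CochainComplex B.FullSubcategory ℤ) : Prop :=
  {i : ℤ | ¬ IsZero (F.obj (X.X i))}.Finite

variable {T : Type u₁} [Category.{v₁} T] [HasZeroObject T] [HasShift T ℤ] [Preadditive T]
  [∀ n : ℤ, (shiftFunctor T n).Additive] [Pretriangulated T] (ι : T ⥤ C)

/-- For every object `M` of `T` (regarded as an object of `C` via `ι`, which will be the embedding
of a triangulated subcategory) the weight complex of `M` is homotopy equivalent to a complex
`(M^i)` over `B` such that `F(M^i) = 0` for almost all `i`. -/
def IsFinite {A : Type u₂} [Category.{v₂} A] (F : B.FullSubcategory ⥤ A) : Prop :=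
  ∀ M : T, ∃ X : CochainComplex B.FullSubcategory ℤ,
    w.IsModel hB (ι.obj M) X ∧ FinitelySupported F X

/-- `φ` is the homomorphism `F_{K_0}`: it sends `[M]` to `∑ (-1)^i [F(M^i)]` for all objects `M` of
`T` and all complexes `(M^i)` over `B` that are homotopy equivalent to the weight complex of `M` and
satisfy `F(M^i) = 0` for almost all `i`. -/
def IsEulerHom {A : Type u₂} [Category.{v₂} A] [Preadditive A] [HasBinaryBiproducts A]
    (F : B.FullSubcategory ⥤ A) (φ : K0Tr T →+ K0Add A) : Prop :=
  ∀ (M : T) (X : CochainComplex B.FullSubcategory ℤ),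
    w.IsModel hB (ι.obj M) X → FinitelySupported F X →
      φ (K0Tr.mk M) = ∑ᶠ i : ℤ, (i.negOnePow : ℤ) • K0Add.mk (F.obj (X.X i))

/-- `H` is (isomorphic to) the value `H^F(M)`, i.e. to the zeroth homology of the complex
`(F(M^i))`, where `(M^i)` is a complex over `B` homotopy equivalent to the weight complex of `M`.
The value `H^F_j(M)` is `H^F(M⟦-j⟧)`. -/
def IsPureValue {A : Type u₂} [Category.{v₂} A] [Abelian A] (F : B.FullSubcategory ⥤ A)
    [F.Additive] (M : C) (H : A) : Prop :=
  ∃ X : CochainComplex B.FullSubcategory ℤ, w.IsModel hB M X ∧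
    Nonempty (((F.mapHomologicalComplex (ComplexShape.up ℤ)).obj X).homology 0 ≅ H)

/-- `Z` is a cone of some morphism from `X` to `Y`. -/
def IsConeOfHom (X Y Z : T) : Prop :=
  ∃ (f : X ⟶ Y) (g : Y ⟶ Z) (h : Z ⟶ X⟦(1 : ℤ)⟧), Triangle.mk f g h ∈ distTriang T

variable {D : Type u₃} [Category.{v₃} D] [HasZeroObject D] [HasShift D ℤ] [Preadditive D]
  [∀ n : ℤ, (shiftFunctor D n).Additive] [Pretriangulated D]

/-- An exact functor `G` is weight-exact if it respects both classes. -/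
structure WeightExact (v : WeightStructure D) (G : C ⥤ D) : Prop where
  le : ∀ X : C, w.le X → v.le (G.obj X)
  ge : ∀ X : C, w.ge X → v.ge (G.obj X)

variable {w} in
/-- The restriction of a weight-exact functor to hearts. -/
def WeightExact.heartFunctor {v : WeightStructure D} {G : C ⥤ D} (hG : w.WeightExact v G) :
    w.Heart ⥤ v.Heart :=
  v.heart.lift (w.heart.ι ⋙ G) (fun X => ⟨hG.le _ X.property.1, hG.ge _ X.property.2⟩)

end WeightStructure

end Triangulated

end Weights

end

/-! ### Orthogonality and extensions for the classes of a weight structure. -/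

noncomputable section

namespace Weights

/-! Everything rests on weak exactness of the weight complex (`exists_distTriang_complex`). Given a
distinguished triangle W → X → Y and towers of W and X, the map W → X lifts to maps w_{≤ -n-1} W →
w_{≤ -n} X. Their cones are candidates for w_{≤ -n} Y, and the factors of Y become extensions of
factors of X by shifted factors of W. These extensions split by orthogonality, so t(X) → t(Y) →
t(W)[1] is a degreewise split sequence of complexes and hence gives a distinguished triangle in
K(Hw). Since cones are not functorial, the tower of Y is built outwards from index 0 by the 3 × 3
lemma (`exists_nine`).

Applied to id_M, weak exactness shows that t(M) does not depend on the tower, because the complex of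
a zero object is contractible. Applied to M → 0 → M[1], it computes the complexes of shifts. As B is
full in Hw, K(B) → K(Hw) is fully faithful, so the B-complexes representing t(M) are unique up to
homotopy equivalence over B, and the one for a cone can be taken to be a mapping cone.

On the side of K_0, the Euler characteristic of a complex with finitely many nonzero terms is
additive on mapping cones, and it vanishes on contractible complexes (`eulerChar_eq_zero`); hence it
is a homotopy invariant. This gives F_{K_0}. If B strongly generates C, the map [b] ↦ [b] from
K_0^add(B) to K_0^tr(C) is surjective, and the Euler characteristic for id_B is a left inverse of
it, so both are isomorphisms. The remaining statements come from the long exact homology sequence,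
from splitting a complex into boundaries and homology in the semi-simple case, and from the fact
that a weight-exact functor carries towers to towers. -/

lemma distTriang_mk_of_iso₂ {C : Type u} [Category.{v} C] [HasZeroObject C] [HasShift C ℤ]
    [Preadditive C] [∀ n : ℤ, (shiftFunctor C n).Additive] [Pretriangulated C]
    {T : Triangle C} (hT : T ∈ distTriang C) {M : C} (e : T.obj₂ ≅ M) :
    Triangle.mk (T.mor₁ ≫ e.hom) (e.inv ≫ T.mor₂) T.mor₃ ∈ distTriang C :=
  isomorphic_distinguished _ hT _
    (Triangle.isoMk _ _ (Iso.refl _) e.symm (Iso.refl _)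
      (by change (T.mor₁ ≫ e.hom) ≫ e.inv = 𝟙 T.obj₁ ≫ T.mor₁; simp)
      (by change (e.inv ≫ T.mor₂) ≫ 𝟙 T.obj₃ = e.inv ≫ T.mor₂; simp)
      (by change T.mor₃ ≫ (𝟙 T.obj₁)⟦(1 : ℤ)⟧' = 𝟙 T.obj₃ ≫ T.mor₃; simp))

namespace WeightStructure

section Basic

variable {C : Type u} [Category.{v} C] [HasZeroObject C] [HasShift C ℤ] [Preadditive C]
  [∀ n : ℤ, (shiftFunctor C n).Additive] [Pretriangulated C] (w : WeightStructure C)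

lemma le_of_iso {X Y : C} (e : X ≅ Y) (h : w.le X) : w.le Y :=
  w.le_retracts.of_retract e.symm.retract h

lemma ge_of_iso {X Y : C} (e : X ≅ Y) (h : w.ge X) : w.ge Y :=
  w.ge_retracts.of_retract e.symm.retract h

variable {w}

lemma IsLE.shift {i : ℤ} {X : C} (h : w.IsLE i X) (n j : ℤ) (hj : i + n = j) :
    w.IsLE j (X⟦n⟧) :=
  w.le_of_iso ((shiftFunctorAdd' C n (-j) (-i) (by lia)).app X) h

lemma IsGE.shift {i : ℤ} {X : C} (h : w.IsGE i X) (n j : ℤ) (hj : i + n = j) :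
    w.IsGE j (X⟦n⟧) :=
  w.ge_of_iso ((shiftFunctorAdd' C n (-j) (-i) (by lia)).app X) h

lemma isLE_zero_iff {X : C} : w.IsLE 0 X ↔ w.le X :=
  ⟨fun h => w.le_of_iso ((shiftFunctorZero' C (-0 : ℤ) (by simp)).app X) h,
    fun h => w.le_of_iso ((shiftFunctorZero' C (-0 : ℤ) (by simp)).app X).symm h⟩

lemma isGE_zero_iff {X : C} : w.IsGE 0 X ↔ w.ge X :=
  ⟨fun h => w.ge_of_iso ((shiftFunctorZero' C (-0 : ℤ) (by simp)).app X) h,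
    fun h => w.ge_of_iso ((shiftFunctorZero' C (-0 : ℤ) (by simp)).app X).symm h⟩

lemma IsLE.mono {i j : ℤ} {X : C} (h : w.IsLE i X) (hij : i ≤ j) : w.IsLE j X := by
  obtain ⟨n, rfl⟩ := Int.le.dest hij
  clear hij
  induction n with
  | zero => simpa using h
  | succ n hn =>
    exact w.le_of_iso ((shiftFunctorAdd' C (-(i + n)) (-1) (-(i + (n + 1 : ℕ)))
      (by push_cast; lia)).app X).symm (w.le_shift _ hn)

lemma IsGE.mono {i j : ℤ} {X : C} (h : w.IsGE i X) (hij : j ≤ i) : w.IsGE j X := by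
  obtain ⟨n, rfl⟩ := Int.le.dest hij
  clear hij
  induction n with
  | zero => simpa using h
  | succ n hn =>
    exact hn (w.ge_of_iso ((shiftFunctorAdd' C (-(j + (n + 1 : ℕ))) 1 (-(j + n))
      (by push_cast; lia)).app X).symm (w.ge_shift _ h))

lemma IsLE.hom_eq_zero {i j : ℤ} {X Y : C} (hX : w.IsLE i X) (hY : w.IsGE j Y) (hij : i < j)
    (f : X ⟶ Y) : f = 0 := by
  have hY' : w.IsGE (i + 1) Y := hY.mono hij
  apply (shiftFunctor C (-i)).map_injective
  let e := (shiftFunctorAdd' C (-(i + 1)) 1 (-i) (by lia)).app Y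
  have := w.orthogonal _ _ hX hY' (f⟦-i⟧' ≫ e.hom)
  rw [← cancel_mono e.hom, this, Functor.map_zero, zero_comp]

/-- Together with `IsLE.hom_eq_zero` this makes the classes orthogonals of each other, so that
closure under extensions can be read off from exact Hom sequences. -/
lemma isLE_of_orthogonal {i : ℤ} {X : C} (h : ∀ Y : C, w.IsGE (i + 1) Y → ∀ f : X ⟶ Y, f = 0) :
    w.IsLE i X := by
  refine w.le_of_orthogonal _ (fun Y hY f => ?_)
  apply (shiftFunctor C i).map_injective
  let e := (shiftFunctorCompIsoId C (-i) i (by lia)).app X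
  have := h _ (((isGE_zero_iff.2 hY).shift 1 1 (by lia)).shift i (i + 1) (by lia))
    (e.inv ≫ f⟦i⟧')
  rw [← cancel_epi e.inv, this, Functor.map_zero, comp_zero]

lemma isGE_of_orthogonal {i : ℤ} {Y : C} (h : ∀ X : C, w.IsLE (i - 1) X → ∀ f : X ⟶ Y, f = 0) :
    w.IsGE i Y := by
  refine w.ge_of_orthogonal _ (fun X hX f => ?_)
  apply (shiftFunctor C (i - 1)).map_injective
  let e := (shiftFunctorAdd' C (-i + 1) (i - 1) 0 (by lia)).app Y
  let e' := (shiftFunctor C (i - 1)).mapIso ((shiftFunctorAdd' C (-i) 1 (-i + 1) rfl).app Y)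
  let e'' := (shiftFunctorZero C ℤ).app Y
  have := h _ ((isLE_zero_iff.2 hX).shift (i - 1) (i - 1) (by lia))
    (f⟦i - 1⟧' ≫ e'.inv ≫ e.inv ≫ e''.hom)
  rw [← cancel_mono (e'.inv ≫ e.inv ≫ e''.hom), this, Functor.map_zero, zero_comp]

lemma IsLE.ext₂ {T : Triangle C} (hT : T ∈ distTriang C) {i : ℤ} (h₁ : w.IsLE i T.obj₁)
    (h₃ : w.IsLE i T.obj₃) : w.IsLE i T.obj₂ := by
  refine isLE_of_orthogonal (fun Y hY f => ?_)
  obtain ⟨g, rfl⟩ := T.yoneda_exact₂ hT f (h₁.hom_eq_zero hY (by lia) _)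
  rw [h₃.hom_eq_zero hY (by lia) g, comp_zero]

lemma IsGE.ext₂ {T : Triangle C} (hT : T ∈ distTriang C) {i : ℤ} (h₁ : w.IsGE i T.obj₁)
    (h₃ : w.IsGE i T.obj₃) : w.IsGE i T.obj₂ := by
  refine isGE_of_orthogonal (fun X hX f => ?_)
  obtain ⟨g, rfl⟩ := T.coyoneda_exact₂ hT f (hX.hom_eq_zero h₃ (by lia) _)
  rw [hX.hom_eq_zero h₁ (by lia) g, zero_comp]

lemma IsLE.ext₃ {T : Triangle C} (hT : T ∈ distTriang C) {i j : ℤ} (hij : i + 1 = j)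
    (h₁ : w.IsLE i T.obj₁) (h₂ : w.IsLE j T.obj₂) : w.IsLE j T.obj₃ :=
  IsLE.ext₂ (rot_of_distTriang _ hT) h₂ (h₁.shift 1 j hij)

lemma IsGE.ext₁ {T : Triangle C} (hT : T ∈ distTriang C) {i j : ℤ} (hij : j = i + 1)
    (h₂ : w.IsGE i T.obj₂) (h₃ : w.IsGE j T.obj₃) : w.IsGE i T.obj₁ :=
  IsGE.ext₂ (inv_rot_of_distTriang _ hT) (h₃.shift (-1) i (by lia)) h₂

lemma isLE_of_isZero (i : ℤ) {X : C} (hX : IsZero X) : w.IsLE i X :=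
  isLE_of_orthogonal (fun _ _ _ => hX.eq_of_src _ _)

lemma isGE_of_isZero (i : ℤ) {X : C} (hX : IsZero X) : w.IsGE i X :=
  isGE_of_orthogonal (fun _ _ _ => hX.eq_of_tgt _ _)

lemma heart_shift {X : C} {i n : ℤ} (h₁ : w.IsLE i X) (h₂ : w.IsGE i X) (hn : i + n = 0) :
    w.heart (X⟦n⟧) :=
  ⟨isLE_zero_iff.1 (h₁.shift n 0 hn), isGE_zero_iff.1 (h₂.shift n 0 hn)⟩

variable (w) in
lemma exists_decomposition_le (M : C) (i j : ℤ) (hij : i + 1 = j) :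
    ∃ (L R : C) (f : L ⟶ M) (g : M ⟶ R) (h : R ⟶ L⟦(1 : ℤ)⟧),
      Triangle.mk f g h ∈ distTriang C ∧ w.IsLE i L ∧ w.IsGE j R := by
  obtain ⟨L, R, f, g, h, hT, hL, hR⟩ := w.exists_decomposition (M⟦-i⟧)
  have hL' := (isLE_zero_iff.2 hL).shift i i (by lia)
  have hR' : w.IsGE j (R⟦i⟧) := (show w.IsGE 1 R from hR).shift i j (by lia)
  let e := (shiftFunctorCompIsoId C (-i) i (by lia)).app M
  let T := (CategoryTheory.Pretriangulated.Triangle.shiftFunctor C i).obj (Triangle.mk f g h)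
  have hT' : T ∈ distTriang C := Triangle.shift_distinguished _ hT i
  refine ⟨L⟦i⟧, R⟦i⟧, T.mor₁ ≫ e.hom, e.inv ≫ T.mor₂, T.mor₃, ?_, hL', hR'⟩
  exact distTriang_mk_of_iso₂ hT' e

end Basic

end WeightStructure

end Weights

end

/-! ### The 3 × 3 lemma and the complex of a Postnikov tower. -/

noncomputable section

namespace Weights

section NineLemma

variable {C : Type u} [Category.{v} C] [HasZeroObject C] [HasShift C ℤ] [Preadditive C]
  [∀ n : ℤ, (shiftFunctor C n).Additive] [Pretriangulated C]

lemma rotate_distTriang_mk {X Y Z : C} {f : X ⟶ Y} {g : Y ⟶ Z} {h : Z ⟶ X⟦(1 : ℤ)⟧}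
    (hT : Triangle.mk f g h ∈ distTriang C) :
    Triangle.mk g h (-f⟦(1 : ℤ)⟧') ∈ distTriang C :=
  rot_of_distTriang _ hT

lemma distTriang_mk_of_rotate {X Y Z : C} {f : X ⟶ Y} {g : Y ⟶ Z} {h : Z ⟶ X⟦(1 : ℤ)⟧}
    (hT : Triangle.mk g h (-f⟦(1 : ℤ)⟧') ∈ distTriang C) :
    Triangle.mk f g h ∈ distTriang C :=
  (rotate_distinguished_triangle _).2 hT

variable [IsTriangulated C]

lemma exists_octahedron {X₁ X₂ X₃ Z₁₂ Z₂₃ Z₁₃ : C} {u₁₂ : X₁ ⟶ X₂} {u₂₃ : X₂ ⟶ X₃}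
    {v₁₂ : X₂ ⟶ Z₁₂} {w₁₂ : Z₁₂ ⟶ X₁⟦(1 : ℤ)⟧} (h₁₂ : Triangle.mk u₁₂ v₁₂ w₁₂ ∈ distTriang C)
    {v₂₃ : X₃ ⟶ Z₂₃} {w₂₃ : Z₂₃ ⟶ X₂⟦(1 : ℤ)⟧} (h₂₃ : Triangle.mk u₂₃ v₂₃ w₂₃ ∈ distTriang C)
    {v₁₃ : X₃ ⟶ Z₁₃} {w₁₃ : Z₁₃ ⟶ X₁⟦(1 : ℤ)⟧}
    (h₁₃ : Triangle.mk (u₁₂ ≫ u₂₃) v₁₃ w₁₃ ∈ distTriang C) :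
    ∃ (m₁ : Z₁₂ ⟶ Z₁₃) (m₃ : Z₁₃ ⟶ Z₂₃), v₁₂ ≫ m₁ = u₂₃ ≫ v₁₃ ∧ m₁ ≫ w₁₃ = w₁₂ ∧
      v₁₃ ≫ m₃ = v₂₃ ∧ w₁₃ ≫ u₁₂⟦(1 : ℤ)⟧' = m₃ ≫ w₂₃ ∧
      Triangle.mk m₁ m₃ (w₂₃ ≫ v₁₂⟦(1 : ℤ)⟧') ∈ distTriang C :=
  let o := Triangulated.someOctahedron rfl h₁₂ h₂₃ h₁₃
  ⟨o.m₁, o.m₃, o.comm₁, o.comm₂, o.comm₃, o.comm₄, o.mem⟩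

/-- The octahedron with fibres in place of cones. It serves at negative indices, where the upper
parts of weight decompositions are built first and the lower parts are their fibres. -/
lemma exists_octahedron' {X₁ X₂ X₃ Z₁₂ Z₂₃ Z₁₃ : C} {u₁₂ : X₁ ⟶ X₂} {u₂₃ : X₂ ⟶ X₃}
    {v₁₂ : Z₁₂ ⟶ X₁} {w₁₂ : X₂ ⟶ Z₁₂⟦(1 : ℤ)⟧} (h₁₂ : Triangle.mk v₁₂ u₁₂ w₁₂ ∈ distTriang C)
    {v₂₃ : Z₂₃ ⟶ X₂} {w₂₃ : X₃ ⟶ Z₂₃⟦(1 : ℤ)⟧} (h₂₃ : Triangle.mk v₂₃ u₂₃ w₂₃ ∈ distTriang C)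
    {v₁₃ : Z₁₃ ⟶ X₁} {w₁₃ : X₃ ⟶ Z₁₃⟦(1 : ℤ)⟧}
    (h₁₃ : Triangle.mk v₁₃ (u₁₂ ≫ u₂₃) w₁₃ ∈ distTriang C) :
    ∃ (m₁ : Z₁₂ ⟶ Z₁₃) (m₃ : Z₁₃ ⟶ Z₂₃), m₁ ≫ v₁₃ = v₁₂ ∧ w₁₂ ≫ m₁⟦(1 : ℤ)⟧' = u₂₃ ≫ w₁₃ ∧
      w₁₃ ≫ m₃⟦(1 : ℤ)⟧' = w₂₃ ∧ m₃ ≫ v₂₃ = v₁₃ ≫ u₁₂ ∧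
      Triangle.mk m₁ m₃ (v₂₃ ≫ w₁₂) ∈ distTriang C :=
  let o := Triangulated.someOctahedron' rfl h₁₂ h₂₃ h₁₃
  ⟨o.m₁, o.m₃, o.comm₁, o.comm₂, o.comm₃, o.comm₄, o.mem⟩

/-- The `3 × 3` lemma: a commutative square, with given cones of its four sides, is completed to a
diagram whose rows and columns are distinguished. -/
lemma exists_nine {W X Y W' X' Y' W'' X'' : C}
    {c : W ⟶ X} {j : X ⟶ Y} {q : Y ⟶ W⟦(1 : ℤ)⟧} (hr : Triangle.mk c j q ∈ distTriang C)
    {c' : W' ⟶ X'} {j' : X' ⟶ Y'} {q' : Y' ⟶ W'⟦(1 : ℤ)⟧}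
    (hr' : Triangle.mk c' j' q' ∈ distTriang C)
    {a : W ⟶ W'} {a₁ : W' ⟶ W''} {a₂ : W'' ⟶ W⟦(1 : ℤ)⟧}
    (ha : Triangle.mk a a₁ a₂ ∈ distTriang C)
    {x : X ⟶ X'} {x₁ : X' ⟶ X''} {x₂ : X'' ⟶ X⟦(1 : ℤ)⟧}
    (hx : Triangle.mk x x₁ x₂ ∈ distTriang C) (comm : c ≫ x = a ≫ c') :
    ∃ (Y'' : C) (b : Y ⟶ Y') (b₁ : Y' ⟶ Y'') (b₂ : Y'' ⟶ Y⟦(1 : ℤ)⟧)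
      (c'' : W'' ⟶ X'') (j'' : X'' ⟶ Y'') (q'' : Y'' ⟶ W''⟦(1 : ℤ)⟧),
      Triangle.mk b b₁ b₂ ∈ distTriang C ∧ Triangle.mk c'' j'' q'' ∈ distTriang C ∧
      j ≫ b = x ≫ j' ∧ b ≫ q' = q ≫ a⟦(1 : ℤ)⟧' ∧
      x₁ ≫ j'' = j' ≫ b₁ ∧ j'' ≫ b₂ = x₂ ≫ j⟦(1 : ℤ)⟧' ∧
      b₁ ≫ q'' = q' ≫ a₁⟦(1 : ℤ)⟧' ∧ q'' ≫ a₂⟦(1 : ℤ)⟧' = - b₂ ≫ q⟦(1 : ℤ)⟧' := by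
  -- Both ways around the square factor the same diagonal, with cone `E`; the two octahedra give Y →
  -- E → Y'. The octahedron on this composite, whose two factors have cones X'' and W''[1], yields
  -- the last row up to rotation.
  obtain ⟨E, e₁, e₂, hE⟩ := distinguished_cocone_triangle (c ≫ x)
  obtain ⟨m₁, m₃, h₁₁, h₁₂, h₁₃, h₁₄, h₁⟩ := exists_octahedron hr hx hE
  obtain ⟨n₁, n₃, h₂₁, h₂₂, h₂₃, h₂₄, h₂⟩ := exists_octahedron ha hr' (comm ▸ hE)
  obtain ⟨Y'', b₁, b₂, hb⟩ := distinguished_cocone_triangle (m₁ ≫ n₃)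
  obtain ⟨p₁, p₃, h₃₁, h₃₂, h₃₃, h₃₄, h₃⟩ := exists_octahedron h₁ (rotate_distTriang_mk h₂) hb
  refine ⟨Y'', m₁ ≫ n₃, b₁, b₂, n₁ ≫ m₃, p₁, p₃, hb, ?_, ?_, ?_, ?_, h₃₂, h₃₃, ?_⟩
  · apply distTriang_mk_of_rotate
    rwa [Functor.map_comp, ← Preadditive.neg_comp]
  · rw [reassoc_of% h₁₁, h₂₃]
  · rw [assoc, ← h₂₄, reassoc_of% h₁₂]
  · rw [← h₁₃, assoc, h₃₁, reassoc_of% h₂₃]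
  · rw [← h₂₂, Functor.map_comp, ← h₁₂, Functor.map_comp, reassoc_of% h₃₄]
    simp

end NineLemma

section ShiftHomSucc

variable {C : Type u} [Category.{v} C] [HasShift C ℤ] {A B D : C}

/-- The morphism `A⟦n⟧ ⟶ B⟦n + 1⟧` induced by a morphism `A ⟶ B⟦1⟧`. -/
def shiftHomSucc (n : ℤ) (f : A ⟶ B⟦(1 : ℤ)⟧) : A⟦n⟧ ⟶ B⟦n + 1⟧ :=
  f⟦n⟧' ≫ (shiftFunctorAdd' C 1 n (n + 1) (add_comm 1 n)).inv.app B

lemma map_comp_shiftHomSucc (n : ℤ) (g : A ⟶ B) (f : B ⟶ D⟦(1 : ℤ)⟧) :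
    g⟦n⟧' ≫ shiftHomSucc n f = shiftHomSucc n (g ≫ f) := by
  simp [shiftHomSucc]

lemma shiftHomSucc_comp_map (n : ℤ) (f : A ⟶ B⟦(1 : ℤ)⟧) (g : B ⟶ D) :
    shiftHomSucc n f ≫ g⟦n + 1⟧' = shiftHomSucc n (f ≫ g⟦(1 : ℤ)⟧') := by
  rw [shiftHomSucc, shiftHomSucc, assoc, ← NatTrans.naturality, Functor.map_comp, assoc]
  rfl

lemma shiftHomSucc_comp (n : ℤ) (f : A ⟶ B⟦(1 : ℤ)⟧) (g : B ⟶ D⟦(1 : ℤ)⟧) :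
    shiftHomSucc n f ≫ shiftHomSucc (n + 1) g = shiftHomSucc n (f ≫ g⟦(1 : ℤ)⟧') ≫
      (shiftFunctorAdd' C 1 (n + 1) (n + 1 + 1) (add_comm 1 _)).inv.app D := by
  rw [← shiftHomSucc_comp_map, assoc]
  rfl

variable [Preadditive C] [∀ n : ℤ, (shiftFunctor C n).Additive]

lemma shiftHomSucc_zero (n : ℤ) : shiftHomSucc n (0 : A ⟶ B⟦(1 : ℤ)⟧) = 0 := by
  simp [shiftHomSucc]

lemma shiftHomSucc_neg (n : ℤ) (f : A ⟶ B⟦(1 : ℤ)⟧) :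
    shiftHomSucc n (-f) = -shiftHomSucc n f := by
  simp [shiftHomSucc]

/-- The anticommuting corner of the 3 × 3 diagram is absorbed by the sign of the differential of a
shifted complex. -/
lemma shiftHomSucc_comp_neg (n : ℤ) {A' : C} {a : A ⟶ B⟦(1 : ℤ)⟧} {q' : B ⟶ D⟦(1 : ℤ)⟧}
    {q : A ⟶ A'⟦(1 : ℤ)⟧} {b : A' ⟶ D⟦(1 : ℤ)⟧}
    (h : a ≫ q'⟦(1 : ℤ)⟧' = - q ≫ b⟦(1 : ℤ)⟧') :
    shiftHomSucc n q ≫ (- shiftHomSucc (n + 1) b) =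
      shiftHomSucc n a ≫ shiftHomSucc (n + 1) q' := by
  rw [Preadditive.comp_neg, shiftHomSucc_comp, shiftHomSucc_comp, h, shiftHomSucc_neg,
    Preadditive.neg_comp]

end ShiftHomSucc

namespace WeightStructure

variable {C : Type u} [Category.{v} C] [HasZeroObject C] [HasShift C ℤ] [Preadditive C]
  [∀ n : ℤ, (shiftFunctor C n).Additive] [Pretriangulated C] {w : WeightStructure C}

namespace PostnikovTower

section

variable {M : C} (T : w.PostnikovTower M)

/-- A choice of cones of the morphisms `w_{≤ -n} M ⟶ M` of a Postnikov tower, with the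
connecting triangles given by octahedra. -/
structure Cofibers where
  R : ℤ → C
  y : ∀ n : ℤ, M ⟶ R n
  z : ∀ n : ℤ, R n ⟶ (T.obj n)⟦(1 : ℤ)⟧
  dist : ∀ n : ℤ, Triangle.mk (T.toObj n) (y n) (z n) ∈ distTriang C
  isGE : ∀ n : ℤ, w.IsGE (-n + 1) (R n)
  ε : ∀ n : ℤ, T.factor n ⟶ R (n + 1)
  r : ∀ n : ℤ, R (n + 1) ⟶ R n
  dist_r : ∀ n : ℤ, Triangle.mk (ε n) (r n) (z n ≫ (T.π n)⟦(1 : ℤ)⟧') ∈ distTriang C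
  ε_z : ∀ n : ℤ, ε n ≫ z (n + 1) = T.δ n

lemma nonempty_cofibers [IsTriangulated C] : Nonempty T.Cofibers := by
  choose R y z hd hge using T.isGE
  let o (n : ℤ) := Triangulated.someOctahedron (T.comm n) (T.distinguished n) (hd n) (hd (n + 1))
  exact ⟨{ R := R, y := y, z := z, dist := hd, isGE := hge
           ε := fun n => (o n).m₁
           r := fun n => (o n).m₃
           dist_r := fun n => (o n).mem
           ε_z := fun n => (o n).comm₂ }⟩

lemma isLE_factor (n : ℤ) : w.IsLE (-n) (T.factor n) :=
  IsLE.ext₃ (T.distinguished n) (i := -(n + 1)) (by lia) (T.isLE (n + 1)) (T.isLE n)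

lemma π_δ (n : ℤ) : T.π n ≫ T.δ n = 0 :=
  comp_distTriang_mor_zero₂₃ _ (T.distinguished n)

lemma d_eq (n : ℤ) : T.d n = shiftHomSucc n (T.δ n ≫ (T.π (n + 1))⟦(1 : ℤ)⟧') := rfl

lemma d_comp_d (n : ℤ) : T.d n ≫ T.d (n + 1) = 0 := by
  rw [d_eq, d_eq]
  refine (shiftHomSucc_comp n _ _).trans ?_
  rw [assoc, ← Functor.map_comp, ← assoc (T.π (n + 1)), π_δ]
  simp only [zero_comp, comp_zero, Functor.map_zero, shiftHomSucc_zero]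
  rfl

variable [IsTriangulated C]

/-- The octahedron on w_{≤ -n-1} M → w_{≤ -n} M → M makes the factor the fibre of `R (n + 1)` → `R
n`, which bounds its weights from below; its description as a cone bounds them from above. -/
lemma isGE_factor (n : ℤ) : w.IsGE (-n) (T.factor n) := by
  obtain ⟨c⟩ := T.nonempty_cofibers
  exact IsGE.ext₁ (c.dist_r n) rfl ((c.isGE (n + 1)).mono (by lia)) (c.isGE n)

lemma heart_X (n : ℤ) : w.heart (T.X n) :=
  heart_shift (T.isLE_factor n) (T.isGE_factor n) (by lia)

/-- The complex over the heart associated with a Postnikov tower. -/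
def complex : CochainComplex w.Heart ℤ :=
  CochainComplex.of (fun n => ⟨T.X n, T.heart_X n⟩) (fun n => ObjectProperty.homMk (T.d n))
    (fun n => by ext; exact T.d_comp_d n)

lemma complex_d (n : ℤ) : T.complex.d n (n + 1) = ObjectProperty.homMk (T.d n) :=
  CochainComplex.of_d (fun n => (⟨T.X n, T.heart_X n⟩ : w.Heart))
    (fun n => ObjectProperty.homMk (T.d n)) n

lemma isWeightComplex_complex : w.IsWeightComplex M T.complex :=
  ⟨T, fun n => Iso.refl _, fun n => by
    rw [complex_d]
    exact (comp_id (T.d n)).trans (id_comp (T.d n)).symm⟩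

end

end PostnikovTower

lemma IsWeightComplex.exists_iso [IsTriangulated C] {M : C} {K : CochainComplex w.Heart ℤ}
    (h : w.IsWeightComplex M K) : ∃ T : w.PostnikovTower M, Nonempty (K ≅ T.complex) := by
  obtain ⟨T, e, he⟩ := h
  refine ⟨T, ⟨HomologicalComplex.Hom.isoOfComponents
    (fun n => w.heart.fullyFaithfulι.preimageIso (e n)) ?_⟩⟩
  rintro i j hij
  obtain rfl : i + 1 = j := hij
  apply w.heart.ι.map_injective
  rw [Functor.map_comp, Functor.map_comp]
  change (e i).hom ≫ w.heart.ι.map (T.complex.d i (i + 1)) =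
    w.heart.ι.map (K.d i (i + 1)) ≫ (e (i + 1)).hom
  rw [he, PostnikovTower.complex_d]
  rfl

end WeightStructure

end Weights

end

/-! ### Building a tower of a cone, stage by stage. -/

noncomputable section

namespace Weights

/-- Two-sided dependent choice over the integers. -/
lemma exists_int_section {P : ℤ → Type*} (Rel : ∀ n : ℤ, P n → P (n + 1) → Prop) (p₀ : P 0)
    (up : ∀ n : ℤ, 0 ≤ n → ∀ p : P n, ∃ p' : P (n + 1), Rel n p p')
    (down : ∀ n : ℤ, n < 0 → ∀ p' : P (n + 1), ∃ p : P n, Rel n p p') :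
    ∃ s : ∀ n : ℤ, P n, ∀ n : ℤ, Rel n (s n) (s (n + 1)) := by
  choose u hu using up
  choose d hd using down
  let sp : ∀ n : ℕ, P (Int.ofNat n) := fun n =>
    Nat.rec (motive := fun n => P (Int.ofNat n)) p₀ (fun n p => u (Int.ofNat n) (by simp) p) n
  let sn : ∀ n : ℕ, P (Int.negSucc n) := fun n =>
    Nat.rec (motive := fun n => P (Int.negSucc n)) (d (Int.negSucc 0) (by simp) p₀)
      (fun n p => d (Int.negSucc (n + 1)) (by simp) p) n
  let s : ∀ n : ℤ, P n := fun n => match n with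
    | .ofNat n => sp n
    | .negSucc n => sn n
  refine ⟨s, fun n => ?_⟩
  match n with
  | .ofNat n => exact hu (Int.ofNat n) (by simp) (sp n)
  | .negSucc 0 => exact hd (Int.negSucc 0) (by simp) p₀
  | .negSucc (n + 1) => exact hd (Int.negSucc (n + 1)) (by simp) (sn n)

namespace WeightStructure

variable {C : Type u} [Category.{v} C] [HasZeroObject C] [HasShift C ℤ] [Preadditive C]
  [∀ n : ℤ, (shiftFunctor C n).Additive] [Pretriangulated C] {w : WeightStructure C}

namespace PostnikovTower

section Comparison

variable {W X : C} (TW : w.PostnikovTower W) (TX : w.PostnikovTower X)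

/-- The drop of index is deliberate: the shift of `TW.obj (n + 1)` by 1 then has weights ≤ -n, just
like `TX.obj n`, so the cone of the lift is again of weight ≤ -n. -/
lemma exists_lift (f : W ⟶ X) (n : ℤ) :
    ∃ c : TW.obj (n + 1) ⟶ TX.obj n, c ≫ TX.toObj n = TW.toObj (n + 1) ≫ f := by
  obtain ⟨R, g, h, hT, hR⟩ := TX.isGE n
  obtain ⟨c, hc⟩ := Triangle.coyoneda_exact₂ _ hT (TW.toObj (n + 1) ≫ f)
    ((TW.isLE (n + 1)).hom_eq_zero hR (by lia) _)
  exact ⟨c, hc.symm⟩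

/-- Two such lifts differ by a morphism through `R⟦-1⟧`, whose weights are ≥ -n. This rigidity makes
the lifts of f commute strictly with the maps of the towers. -/
lemma hom_ext_of_isLE {P : C} {n i : ℤ} (hP : w.IsLE i P) (hi : i < - n)
    {a b : P ⟶ TX.obj n} (h : a ≫ TX.toObj n = b ≫ TX.toObj n) : a = b := by
  obtain ⟨R, g, r, hT, hR⟩ := TX.isGE n
  rw [← sub_eq_zero]
  obtain ⟨c, hc⟩ := Triangle.coyoneda_exact₂ _ (inv_rot_of_distTriang _ hT) (a - b)
    (by
      change (a - b) ≫ TX.toObj n = 0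
      rw [Preadditive.sub_comp, h, sub_self])
  have h0 : c = 0 := hP.hom_eq_zero (hR.shift (-1) (- n) (by lia)) hi c
  rw [hc, h0, zero_comp]
  rfl

lemma lift_comm {f : W ⟶ X} (c : ∀ n : ℤ, TW.obj (n + 1) ⟶ TX.obj n)
    (hc : ∀ n : ℤ, c n ≫ TX.toObj n = TW.toObj (n + 1) ≫ f) (n : ℤ) :
    c (n + 1) ≫ TX.map n = TW.map (n + 1) ≫ c n :=
  TX.hom_ext_of_isLE (TW.isLE (n + 1 + 1)) (by lia) (by
    rw [assoc, assoc, TX.comm, hc, hc, ← TW.comm (n + 1), assoc])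

end Comparison

section Extension

variable {W X : C} {TW : w.PostnikovTower W} {TX : w.PostnikovTower X} (cW : TW.Cofibers)
  (cX : TX.Cofibers) (Y : C) (c : ∀ n : ℤ, TW.obj (n + 1) ⟶ TX.obj n)

/-- A weight decomposition of the third object `Y` of a distinguished triangle `W ⟶ X ⟶ Y`, which
is compatible with those of `W` and `X`: on the lower part if `n` is nonnegative, on the upper part
if `n` is nonpositive. -/
structure Stage (n : ℤ) where
  obj : C
  R : C
  t : obj ⟶ Y
  y : Y ⟶ R
  z : R ⟶ obj⟦(1 : ℤ)⟧
  dist : Triangle.mk t y z ∈ distTriang C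
  isLE : w.IsLE (-n) obj
  isGE : w.IsGE (-n + 1) R
  j : TX.obj n ⟶ obj
  q : obj ⟶ (TW.obj (n + 1))⟦(1 : ℤ)⟧
  dist_obj : 0 ≤ n → Triangle.mk (c n) j q ∈ distTriang C
  k : cW.R (n + 1) ⟶ cX.R n
  j' : cX.R n ⟶ R
  q' : R ⟶ (cW.R (n + 1))⟦(1 : ℤ)⟧
  dist_R : n ≤ 0 → Triangle.mk k j' q' ∈ distTriang C
  j'_z : n = 0 → j' ≫ z = cX.z n ≫ j⟦(1 : ℤ)⟧'
  q'_z : n = 0 → q' ≫ (cW.z (n + 1))⟦(1 : ℤ)⟧' = - z ≫ q⟦(1 : ℤ)⟧'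

variable {cW cX Y c}

/-- A morphism between two consecutive stages with an explicit cone, which is an extension of the
factors of the two given towers. -/
structure StageLink {n : ℤ} (s : Stage cW cX Y c n) (s' : Stage cW cX Y c (n + 1)) where
  factor : C
  b : s'.obj ⟶ s.obj
  π : s.obj ⟶ factor
  δ : factor ⟶ s'.obj⟦(1 : ℤ)⟧
  dist : Triangle.mk b π δ ∈ distTriang C
  b_t : b ≫ s.t = s'.t
  ε : factor ⟶ s'.R
  ε_z : ε ≫ s'.z = δ
  k : TW.factor (n + 1) ⟶ TX.factor n
  j : TX.factor n ⟶ factor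
  q : factor ⟶ (TW.factor (n + 1))⟦(1 : ℤ)⟧
  dist_factor : Triangle.mk k j q ∈ distTriang C
  π_j : 0 ≤ n → TX.π n ≫ j = s.j ≫ π
  j_δ : 0 ≤ n → j ≫ δ = TX.δ n ≫ s'.j⟦(1 : ℤ)⟧'
  π_q : 0 ≤ n → π ≫ q = s.q ≫ (TW.π (n + 1))⟦(1 : ℤ)⟧'
  q_δ : 0 ≤ n → q ≫ (TW.δ (n + 1))⟦(1 : ℤ)⟧' = - δ ≫ s'.q⟦(1 : ℤ)⟧'
  j_ε : n < 0 → j ≫ ε = cX.ε n ≫ s'.j'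
  ε_q : n < 0 → ε ≫ s'.q' = q ≫ (cW.ε (n + 1))⟦(1 : ℤ)⟧'
  j'_z_π : n < 0 → s.j' ≫ s.z ≫ π⟦(1 : ℤ)⟧' = (cX.z n ≫ (TX.π n)⟦(1 : ℤ)⟧') ≫ j⟦(1 : ℤ)⟧'
  q'_z_π : n < 0 → s.q' ≫ (cW.z (n + 1) ≫ (TW.π (n + 1))⟦(1 : ℤ)⟧')⟦(1 : ℤ)⟧' =
    - (s.z ≫ π⟦(1 : ℤ)⟧') ≫ q⟦(1 : ℤ)⟧'

/-- Links carry their compatibilities on the lower parts for n ≥ 0 and on the upper parts for n < 0.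
Hence three cases: both links on one side, both on the other, or meeting at the stage of index 0,
the only one that relates the two sides. -/
lemma StageLink.j_comp {n : ℤ} {s : Stage cW cX Y c n} {s' : Stage cW cX Y c (n + 1)}
    {s'' : Stage cW cX Y c (n + 1 + 1)} (l : StageLink s s') (l' : StageLink s' s'') :
    l.j ≫ l.δ ≫ l'.π⟦(1 : ℤ)⟧' = (TX.δ n ≫ (TX.π (n + 1))⟦(1 : ℤ)⟧') ≫ l'.j⟦(1 : ℤ)⟧' := by
  rcases le_or_gt 0 n with hn | hn
  · rw [reassoc_of% l.j_δ hn, ← Functor.map_comp, ← l'.π_j (by lia), Functor.map_comp, assoc]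
  · rw [← l.ε_z, assoc, reassoc_of% l.j_ε hn]
    rcases (show n + 1 < 0 ∨ n + 1 = 0 by lia) with hn' | hn'
    · rw [l'.j'_z_π hn', ← cX.ε_z, assoc, assoc, assoc]
    · rw [reassoc_of% s'.j'_z hn', ← Functor.map_comp, ← l'.π_j (by lia), Functor.map_comp,
        ← cX.ε_z, assoc, assoc]

lemma StageLink.comp_q {n : ℤ} {s : Stage cW cX Y c n} {s' : Stage cW cX Y c (n + 1)}
    {s'' : Stage cW cX Y c (n + 1 + 1)} (l : StageLink s s') (l' : StageLink s' s'') :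
    (l.δ ≫ l'.π⟦(1 : ℤ)⟧') ≫ l'.q⟦(1 : ℤ)⟧' =
      - l.q ≫ (TW.δ (n + 1) ≫ (TW.π (n + 1 + 1))⟦(1 : ℤ)⟧')⟦(1 : ℤ)⟧' := by
  rcases le_or_gt 0 n with hn | hn
  · rw [assoc, ← Functor.map_comp, l'.π_q (by lia), Functor.map_comp, Functor.map_comp, ← assoc,
      ← assoc, ← Preadditive.neg_comp, l.q_δ hn, neg_neg]
  · rw [← l.ε_z, ← cW.ε_z, assoc, assoc, assoc, Functor.map_comp, ← reassoc_of% l.ε_q hn]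
    rcases (show n + 1 < 0 ∨ n + 1 = 0 by lia) with hn' | hn'
    · rw [l'.q'_z_π hn', Preadditive.comp_neg, neg_neg, assoc]
    · rw [Functor.map_comp, ← assoc s'.q', s'.q'_z hn', ← Functor.map_comp, l'.π_q (by lia)]
      simp

variable [IsTriangulated C]

/-- One 3 × 3 diagram supplies both the lower and the upper row, together with the squares relating
them. -/
lemma nonempty_stage_zero {f : W ⟶ X} {g : X ⟶ Y} {h : Y ⟶ W⟦(1 : ℤ)⟧}
    (hT : Triangle.mk f g h ∈ distTriang C)
    (hc : c 0 ≫ TX.toObj 0 = TW.toObj (0 + 1) ≫ f) : Nonempty (Stage cW cX Y c 0) := by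
  obtain ⟨Y₀, j, q, h₀⟩ := distinguished_cocone_triangle (c 0)
  obtain ⟨R, t, y, z, k, j', q', h₁, h₂, -, -, -, h₆, -, h₈⟩ :=
    exists_nine h₀ hT (cW.dist (0 + 1)) (cX.dist 0) hc
  exact ⟨{
    obj := Y₀, R := R, t := t, y := y, z := z, dist := h₁
    isLE := IsLE.ext₂ (rotate_distTriang_mk h₀) (TX.isLE 0)
      ((TW.isLE (0 + 1)).shift 1 _ (by lia))
    isGE := IsGE.ext₂ (rotate_distTriang_mk h₂) (cX.isGE 0)
      ((cW.isGE (0 + 1)).shift 1 _ (by lia))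
    j := j, q := q, dist_obj := fun _ => h₀, k := k, j' := j', q' := q'
    dist_R := fun _ => h₂, j'_z := fun _ => h₆, q'_z := fun _ => h₈ }⟩

/-- The 3 × 3 lemma on the lower rows produces the next lower part and the factor; the upper part is
just a cone of the composite to Y, its weights being bounded by an octahedron. -/
lemma Stage.exists_succ {n : ℤ} (hn : 0 ≤ n) (s : Stage cW cX Y c n)
    (hc : c (n + 1) ≫ TX.map n = TW.map (n + 1) ≫ c n) :
    ∃ s' : Stage cW cX Y c (n + 1), Nonempty (StageLink s s') := by
  obtain ⟨Y', j', q', h'⟩ := distinguished_cocone_triangle (c (n + 1))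
  obtain ⟨F, b, b₁, b₂, k, jf, qf, hb, hf, h₁, h₂, h₃, h₄, h₅, h₆⟩ :=
    exists_nine h' (s.dist_obj hn) (TW.distinguished (n + 1)) (TX.distinguished n) hc
  obtain ⟨R', y', z', hR'⟩ := distinguished_cocone_triangle (b ≫ s.t)
  obtain ⟨m₁, m₃, -, hm, -, -, hm'⟩ := exists_octahedron hb s.dist hR'
  have hF : w.IsGE (-n) F := IsGE.ext₂ (rotate_distTriang_mk hf) (TX.isGE_factor n)
    ((TW.isGE_factor (n + 1)).shift 1 _ (by lia))
  let s' : Stage cW cX Y c (n + 1) :=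
    { obj := Y', R := R', t := b ≫ s.t, y := y', z := z', dist := hR'
      isLE := IsLE.ext₂ (rotate_distTriang_mk h') (TX.isLE (n + 1))
        ((TW.isLE (n + 1 + 1)).shift 1 _ (by lia))
      isGE := IsGE.ext₂ hm' (hF.mono (by lia)) (s.isGE.mono (by lia))
      -- The zeros are placeholders: at a positive index nothing is required of the upper row.
      j := j', q := q', dist_obj := fun _ => h', k := 0, j' := 0, q' := 0
      dist_R := fun h => by lia
      j'_z := fun h => by lia
      q'_z := fun h => by lia }
  exact ⟨s', ⟨{
    factor := F, b := b, π := b₁, δ := b₂, dist := hb, b_t := rfl, ε := m₁, ε_z := hm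
    k := k, j := jf, q := qf, dist_factor := hf
    π_j := fun _ => h₃, j_δ := fun _ => h₄, π_q := fun _ => h₅, q_δ := fun _ => h₆
    j_ε := fun h => by lia
    ε_q := fun h => by lia
    j'_z_π := fun h => by lia
    q'_z_π := fun h => by lia }⟩⟩

/-- Dual to the previous step, but here the row of factors is prescribed, as a cone of the zero map.
The square to be completed commutes because both of its composites vanish by orthogonality. The
lower part is then the fibre of Y → `R`, and the zeros in it are placeholders. -/
lemma Stage.exists_pred {n : ℤ} (hn : n < 0) (s' : Stage cW cX Y c (n + 1)) :
    ∃ s : Stage cW cX Y c n, Nonempty (StageLink s s') := by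
  obtain ⟨F, jf, qf, hf⟩ :=
    distinguished_cocone_triangle (0 : TW.factor (n + 1) ⟶ TX.factor n)
  have comm : (0 : TW.factor (n + 1) ⟶ TX.factor n) ≫ cX.ε n = cW.ε (n + 1) ≫ s'.k :=
    ((TW.isLE_factor (n + 1)).hom_eq_zero (cX.isGE (n + 1)) (by lia) _).trans
      ((TW.isLE_factor (n + 1)).hom_eq_zero (cX.isGE (n + 1)) (by lia) _).symm
  obtain ⟨R, ε, r, b₂, k, j', q', hb, hR, h₁, h₂, -, h₄, -, h₆⟩ :=
    exists_nine hf (s'.dist_R (by lia)) (cW.dist_r (n + 1)) (cX.dist_r n) comm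
  obtain ⟨Y', t, z, hY'⟩ := distinguished_cocone_triangle₁ (s'.y ≫ r)
  obtain ⟨m₁, m₃, hm₁, -, hm₂, -, hm⟩ := exists_octahedron' s'.dist hb hY'
  have hF : w.IsLE (-n) F := IsLE.ext₂ (rotate_distTriang_mk hf) (TX.isLE_factor n)
    ((TW.isLE_factor (n + 1)).shift 1 _ (by lia))
  let s : Stage cW cX Y c n :=
    { obj := Y', R := R, t := t, y := s'.y ≫ r, z := z, dist := hY'
      isLE := IsLE.ext₂ hm (s'.isLE.mono (by lia)) hF
      isGE := IsGE.ext₂ (rotate_distTriang_mk hR) (cX.isGE n)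
        ((cW.isGE (n + 1)).shift 1 _ (by lia))
      j := 0, q := 0, dist_obj := fun _ => by lia
      k := k, j' := j', q' := q', dist_R := fun _ => hR
      j'_z := fun h => by lia
      q'_z := fun h => by lia }
  exact ⟨s, ⟨{
    factor := F, b := m₁, π := m₃, δ := ε ≫ s'.z, dist := hm, b_t := hm₁, ε := ε, ε_z := rfl
    k := 0, j := jf, q := qf, dist_factor := hf
    π_j := fun h => by lia
    j_δ := fun h => by lia
    π_q := fun h => by lia
    q_δ := fun h => by lia
    j_ε := fun _ => h₁
    ε_q := fun _ => h₂
    j'_z_π := fun _ => by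
      change j' ≫ z ≫ m₃⟦(1 : ℤ)⟧' = _
      rw [hm₂, h₄]
    q'_z_π := fun _ => by
      change q' ≫ _ = - (z ≫ m₃⟦(1 : ℤ)⟧') ≫ _
      rw [hm₂, h₆] }⟩⟩

end Extension

end PostnikovTower

end WeightStructure

end Weights

end

/-! ### The complex of a cone as a degreewise split extension. -/

noncomputable section

namespace Weights

section Pretriangulated

variable {C : Type u} [Category.{v} C] [HasZeroObject C] [HasShift C ℤ] [Preadditive C]
  [∀ n : ℤ, (shiftFunctor C n).Additive] [Pretriangulated C]

lemma exists_splitting_of_distTriang {X Y Z : C} {f : X ⟶ Y} {g : Y ⟶ Z} {h : Z ⟶ X⟦(1 : ℤ)⟧}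
    (hT : Triangle.mk f g h ∈ distTriang C) (h₀ : h = 0) :
    ∃ (r : Y ⟶ X) (s : Z ⟶ Y), f ≫ r = 𝟙 X ∧ s ≫ g = 𝟙 Z ∧ r ≫ f + g ≫ s = 𝟙 Y := by
  have hf : Mono f := Triangle.mono₁ _ hT h₀
  have hfg : f ≫ g = 0 := comp_distTriang_mor_zero₁₂ _ hT
  obtain ⟨s, hs⟩ : ∃ s : Z ⟶ Y, 𝟙 Z = s ≫ g :=
    Triangle.coyoneda_exact₃ _ hT (𝟙 Z) (by subst h₀; exact comp_zero)
  replace hs : s ≫ g = 𝟙 Z := hs.symm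
  obtain ⟨r, hr⟩ : ∃ r : Y ⟶ X, 𝟙 Y - g ≫ s = r ≫ f := Triangle.coyoneda_exact₂ _ hT (𝟙 Y - g ≫ s) (by
    change (𝟙 Y - g ≫ s) ≫ g = 0
    rw [Preadditive.sub_comp, assoc, hs, id_comp, comp_id, sub_self])
  replace hr : r ≫ f = 𝟙 Y - g ≫ s := hr.symm
  refine ⟨r, s, ?_, hs, by rw [hr, sub_add_cancel]⟩
  rw [← cancel_mono f, assoc, hr, Preadditive.comp_sub, reassoc_of% hfg]
  simp

/-- Turns the triangle X → Y → W[1] of a degreewise split sequence back into W → X → Y, when its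
third object is a shift only up to isomorphism. -/
lemma exists_distTriang_of_iso_shift {T : Triangle C} (hT : T ∈ distTriang C) {W : C}
    (e : T.obj₃ ≅ W⟦(1 : ℤ)⟧) :
    ∃ (f : W ⟶ T.obj₁) (h : T.obj₂ ⟶ W⟦(1 : ℤ)⟧), Triangle.mk f T.mor₁ h ∈ distTriang C := by
  let e' : T.obj₃⟦(-1 : ℤ)⟧ ≅ W :=
    (shiftFunctor C (-1 : ℤ)).mapIso e ≪≫ (shiftFunctorCompIsoId C (1 : ℤ) (-1) (by lia)).app W
  refine ⟨e'.inv ≫ T.invRotate.mor₁, T.invRotate.mor₃ ≫ e'.hom⟦(1 : ℤ)⟧', ?_⟩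
  refine isomorphic_distinguished _ (inv_rot_of_distTriang _ hT) _
    (Triangle.isoMk _ _ e'.symm (Iso.refl T.obj₁) (Iso.refl T.obj₂) ?_ ?_ ?_)
  · change (e'.inv ≫ T.invRotate.mor₁) ≫ 𝟙 T.invRotate.obj₂ = e'.inv ≫ T.invRotate.mor₁
    rw [comp_id]
  · change T.mor₁ ≫ 𝟙 T.obj₂ = 𝟙 T.obj₁ ≫ T.mor₁
    rw [comp_id, id_comp]
  · change (T.invRotate.mor₃ ≫ e'.hom⟦(1 : ℤ)⟧') ≫ e'.inv⟦(1 : ℤ)⟧' =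
      𝟙 T.invRotate.obj₃ ≫ T.invRotate.mor₃
    have h : e'.hom⟦(1 : ℤ)⟧' ≫ e'.inv⟦(1 : ℤ)⟧' = 𝟙 (T.obj₃⟦(-1 : ℤ)⟧⟦(1 : ℤ)⟧) := by
      rw [← Functor.map_comp, e'.hom_inv_id, CategoryTheory.Functor.map_id]
    exact (assoc _ _ _).trans ((congrArg (T.invRotate.mor₃ ≫ ·) h).trans
      ((comp_id _).trans (id_comp _).symm))

lemma exists_distTriang_of_iso₃ {T : Triangle C} (hT : T ∈ distTriang C) {Z : C}
    (e : T.obj₃ ≅ Z) :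
    ∃ (g : T.obj₂ ⟶ Z) (h : Z ⟶ T.obj₁⟦(1 : ℤ)⟧), Triangle.mk T.mor₁ g h ∈ distTriang C := by
  refine ⟨T.mor₂ ≫ e.hom, e.inv ≫ T.mor₃, isomorphic_distinguished _ hT _
    (Triangle.isoMk _ _ (Iso.refl T.obj₁) (Iso.refl T.obj₂) e.symm ?_ ?_ ?_)⟩
  · change T.mor₁ ≫ 𝟙 T.obj₂ = 𝟙 T.obj₁ ≫ T.mor₁
    rw [comp_id, id_comp]
  · change (T.mor₂ ≫ e.hom) ≫ e.inv = 𝟙 T.obj₂ ≫ T.mor₂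
    simp
  · change (e.inv ≫ T.mor₃) ≫ (𝟙 T.obj₁)⟦(1 : ℤ)⟧' = e.inv ≫ T.mor₃
    simp

end Pretriangulated

namespace WeightStructure

variable {C : Type u} [Category.{v} C] [HasZeroObject C] [HasShift C ℤ] [Preadditive C]
  [∀ n : ℤ, (shiftFunctor C n).Additive] [Pretriangulated C] {w : WeightStructure C}

namespace PostnikovTower

section Extension

variable {W X Y : C} {TW : w.PostnikovTower W} {TX : w.PostnikovTower X} {cW : TW.Cofibers}
  {cX : TX.Cofibers} {c : ∀ n : ℤ, TW.obj (n + 1) ⟶ TX.obj n}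
  {s : ∀ n : ℤ, Stage cW cX Y c n} (l : ∀ n : ℤ, StageLink (s n) (s (n + 1)))

/-- The Postnikov tower given by a sequence of stages. -/
def ofStages : w.PostnikovTower Y where
  obj n := (s n).obj
  toObj n := (s n).t
  isLE n := (s n).isLE
  isGE n := ⟨_, _, _, (s n).dist, (s n).isGE⟩
  map n := (l n).b
  comm n := (l n).b_t
  factor n := (l n).factor
  π n := (l n).π
  δ n := (l n).δ
  distinguished n := (l n).dist

variable [IsTriangulated C]

/-- The inclusion of the complex of the first tower. -/
def ofStagesInl : TX.complex ⟶ (ofStages l).complex where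
  f n := ObjectProperty.homMk ((l n).j⟦n⟧')
  comm' i i' hi := by
    obtain rfl : i + 1 = i' := hi
    rw [complex_d, complex_d]
    ext
    change (l i).j⟦i⟧' ≫ (ofStages l).d i = TX.d i ≫ (l (i + 1)).j⟦i + 1⟧'
    rw [d_eq, d_eq]
    refine (map_comp_shiftHomSucc i _ _).trans (Eq.trans ?_ (shiftHomSucc_comp_map i _ _).symm)
    exact congrArg _ ((l i).j_comp (l (i + 1)))

/-- The projection to the shifted complex of the second tower. -/
def ofStagesSnd : (ofStages l).complex ⟶ TW.complex⟦(1 : ℤ)⟧ where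
  f n := ObjectProperty.homMk (shiftHomSucc n (l n).q)
  comm' i i' hi := by
    obtain rfl : i + 1 = i' := hi
    rw [complex_d, CochainComplex.shiftFunctor_obj_d', Int.negOnePow_one, Units.neg_smul, one_smul]
    change _ ≫ (- TW.complex.d (i + 1) (i + 1 + 1)) = _
    rw [complex_d]
    ext
    change shiftHomSucc i (l i).q ≫ (- TW.d (i + 1)) =
      (ofStages l).d i ≫ shiftHomSucc (i + 1) (l (i + 1)).q
    exact shiftHomSucc_comp_neg i ((l i).comp_q (l (i + 1)))

lemma exists_ofStages_splitting (n : ℤ) :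
    ∃ (r : (ofStages l).complex.X n ⟶ TX.complex.X n)
      (t : TW.complex.X (n + 1) ⟶ (ofStages l).complex.X n),
      (ofStagesInl l).f n ≫ (ofStagesSnd l).f n = 0 ∧
      (ofStagesInl l).f n ≫ r = 𝟙 _ ∧ t ≫ (ofStagesSnd l).f n = 𝟙 _ ∧
      r ≫ (ofStagesInl l).f n + (ofStagesSnd l).f n ≫ t = 𝟙 _ := by
  -- `TW.factor (n + 1)` has weights ≤ -n-1 and `TX.factor n` has weights ≥ -n; so the triangle of
  -- factors splits.
  have hk : (l n).k = 0 := (TW.isLE_factor (n + 1)).hom_eq_zero (TX.isGE_factor n) (by lia) _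
  obtain ⟨r, t, h₁, h₂, h₃⟩ := exists_splitting_of_distTriang
    (rotate_distTriang_mk (l n).dist_factor) (by rw [hk]; simp)
  have h₄ : (l n).j ≫ (l n).q = 0 := comp_distTriang_mor_zero₂₃ _ (l n).dist_factor
  let e := (shiftFunctorAdd' C 1 n (n + 1) (add_comm 1 n)).app (TW.factor (n + 1))
  refine ⟨ObjectProperty.homMk (r⟦n⟧'), ObjectProperty.homMk (e.hom ≫ t⟦n⟧'), ?_, ?_, ?_, ?_⟩
  · ext
    change (l n).j⟦n⟧' ≫ shiftHomSucc n (l n).q = 0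
    rw [map_comp_shiftHomSucc, h₄, shiftHomSucc_zero]
  · ext
    change (l n).j⟦n⟧' ≫ r⟦n⟧' = 𝟙 _
    rw [← Functor.map_comp, h₁]
    exact CategoryTheory.Functor.map_id _ _
  · ext
    change (e.hom ≫ t⟦n⟧') ≫ (l n).q⟦n⟧' ≫ e.inv = 𝟙 _
    rw [assoc, ← Functor.map_comp_assoc, h₂]
    refine Eq.trans ?_ e.hom_inv_id
    congr 1
    rw [CategoryTheory.Functor.map_id]
    exact id_comp _
  · ext
    change r⟦n⟧' ≫ (l n).j⟦n⟧' + ((l n).q⟦n⟧' ≫ e.inv) ≫ e.hom ≫ t⟦n⟧' = 𝟙 _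
    rw [assoc, e.inv_hom_id_assoc, ← Functor.map_comp, ← Functor.map_comp, ← Functor.map_add, h₃]
    exact CategoryTheory.Functor.map_id _ _

/-- The degreewise split short complex given by a sequence of stages. -/
def ofStagesShortComplex : ShortComplex (CochainComplex w.Heart ℤ) :=
  ShortComplex.mk (ofStagesInl l) (ofStagesSnd l) (by
    ext n : 1
    exact (exists_ofStages_splitting l n).choose_spec.choose_spec.1)

/-- The degreewise splittings of `ofStagesShortComplex`. -/
def ofStagesSplitting (n : ℤ) :
    ((ofStagesShortComplex l).map (HomologicalComplex.eval w.Heart _ n)).Splitting where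
  r := (exists_ofStages_splitting l n).choose
  s := (exists_ofStages_splitting l n).choose_spec.choose
  f_r := (exists_ofStages_splitting l n).choose_spec.choose_spec.2.1
  s_g := (exists_ofStages_splitting l n).choose_spec.choose_spec.2.2.1
  id := (exists_ofStages_splitting l n).choose_spec.choose_spec.2.2.2

end Extension

variable [IsTriangulated C]

/-- Weak exactness of weight complexes. -/
theorem exists_distTriang_complex {W X Y : C} {f : W ⟶ X} {g : X ⟶ Y} {h : Y ⟶ W⟦(1 : ℤ)⟧}
    (hT : Triangle.mk f g h ∈ distTriang C) (TW : w.PostnikovTower W) (TX : w.PostnikovTower X) :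
    ∃ (TY : w.PostnikovTower Y)
      (a : (HomotopyCategory.quotient w.Heart (ComplexShape.up ℤ)).obj TW.complex ⟶
        (HomotopyCategory.quotient w.Heart (ComplexShape.up ℤ)).obj TX.complex)
      (b : (HomotopyCategory.quotient w.Heart (ComplexShape.up ℤ)).obj TX.complex ⟶
        (HomotopyCategory.quotient w.Heart (ComplexShape.up ℤ)).obj TY.complex)
      (c : (HomotopyCategory.quotient w.Heart (ComplexShape.up ℤ)).obj TY.complex ⟶
        ((HomotopyCategory.quotient w.Heart (ComplexShape.up ℤ)).obj TW.complex)⟦(1 : ℤ)⟧),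
      Triangle.mk a b c ∈ distTriang (HomotopyCategory w.Heart (ComplexShape.up ℤ)) := by
  obtain ⟨cW⟩ := TW.nonempty_cofibers
  obtain ⟨cX⟩ := TX.nonempty_cofibers
  choose c hc using exists_lift TW TX f
  have hc' := lift_comm TW TX c hc
  obtain ⟨s₀⟩ := nonempty_stage_zero (cW := cW) (cX := cX) hT (hc 0)
  obtain ⟨s, hs⟩ := exists_int_section (P := Stage cW cX Y c) (fun n s s' => Nonempty (StageLink s s')) s₀
    (fun n hn s => s.exists_succ hn (hc' n)) (fun n hn s' => s'.exists_pred hn)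
  let l (n : ℤ) := (hs n).some
  let S := ofStagesShortComplex l
  have hS : CochainComplex.trianglehOfDegreewiseSplit S (ofStagesSplitting l) ∈ distTriang _ :=
    (HomotopyCategory.distinguished_iff_iso_trianglehOfDegreewiseSplit _).2
      ⟨_, _, ⟨Iso.refl _⟩⟩
  -- No map t(W) → t(X) has been constructed directly: `a` arises from the connecting morphism of
  -- the split sequence by inverse rotation.
  obtain ⟨a, c, hac⟩ := exists_distTriang_of_iso_shift hS
    (((HomotopyCategory.quotient w.Heart (ComplexShape.up ℤ)).commShiftIso (1 : ℤ)).app TW.complex)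
  exact ⟨ofStages l, a, _, c, hac⟩

end PostnikovTower

end WeightStructure

end Weights

end

/-! ### Independence of the weight complex from the tower. -/

noncomputable section

namespace Weights

section Contractible

variable {V : Type u} [Category.{v} V] [Preadditive V]

/-- A cochain complex is contractible if it has contracting morphisms. -/
def homotopyIdZero {K : CochainComplex V ℤ} (h : ∀ n : ℤ, K.X (n + 1) ⟶ K.X n)
    (hh : ∀ n : ℤ, h n ≫ K.d n (n + 1) + K.d (n + 1) (n + 1 + 1) ≫ h (n + 1) = 𝟙 _) :
    Homotopy (𝟙 K) 0 where
  hom i j := if hij : j + 1 = i then (K.XIsoOfEq hij.symm).hom ≫ h j else 0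
  zero i j hij := dif_neg hij
  comm i := by
    obtain ⟨n, rfl⟩ : ∃ n, n + 1 = i := ⟨i - 1, by lia⟩
    rw [dNext_eq _ (show (ComplexShape.up ℤ).Rel (n + 1) (n + 1 + 1) from rfl),
      prevD_eq _ (show (ComplexShape.up ℤ).Rel n (n + 1) from rfl)]
    have := (add_comm _ _).trans (hh n)
    simp [this]

end Contractible

namespace WeightStructure

variable {C : Type u} [Category.{v} C] [HasZeroObject C] [HasShift C ℤ] [Preadditive C]
  [∀ n : ℤ, (shiftFunctor C n).Additive] [Pretriangulated C] {w : WeightStructure C}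

namespace PostnikovTower

lemma exists_map {M : C} {obj : ℤ → C} {toObj : ∀ n : ℤ, obj n ⟶ M}
    (isLE : ∀ n : ℤ, w.IsLE (-n) (obj n))
    (isGE : ∀ n : ℤ, ∃ (R : C) (g : M ⟶ R) (h : R ⟶ (obj n)⟦(1 : ℤ)⟧),
      Triangle.mk (toObj n) g h ∈ distTriang C ∧ w.IsGE (-n + 1) R) (n : ℤ) :
    ∃ (F : C) (a : obj (n + 1) ⟶ obj n) (π : obj n ⟶ F) (δ : F ⟶ (obj (n + 1))⟦(1 : ℤ)⟧),
      a ≫ toObj n = toObj (n + 1) ∧ Triangle.mk a π δ ∈ distTriang C := by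
  obtain ⟨R, g, h, hT, hR⟩ := isGE n
  obtain ⟨a, ha⟩ := Triangle.coyoneda_exact₂ _ hT (toObj (n + 1))
    ((isLE (n + 1)).hom_eq_zero hR (by lia) _)
  obtain ⟨F, π, δ, hF⟩ := distinguished_cocone_triangle a
  exact ⟨F, a, π, δ, ha.symm, hF⟩

/-- The Postnikov tower given by a choice of weight decompositions. -/
def ofDecompositions {M : C} (obj : ℤ → C) (toObj : ∀ n : ℤ, obj n ⟶ M)
    (isLE : ∀ n : ℤ, w.IsLE (-n) (obj n))
    (isGE : ∀ n : ℤ, ∃ (R : C) (g : M ⟶ R) (h : R ⟶ (obj n)⟦(1 : ℤ)⟧),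
      Triangle.mk (toObj n) g h ∈ distTriang C ∧ w.IsGE (-n + 1) R) : w.PostnikovTower M where
  obj := obj
  toObj := toObj
  isLE := isLE
  isGE := isGE
  factor n := (exists_map isLE isGE n).choose
  map n := (exists_map isLE isGE n).choose_spec.choose
  π n := (exists_map isLE isGE n).choose_spec.choose_spec.choose
  δ n := (exists_map isLE isGE n).choose_spec.choose_spec.choose_spec.choose
  comm n := (exists_map isLE isGE n).choose_spec.choose_spec.choose_spec.choose_spec.1
  distinguished n := (exists_map isLE isGE n).choose_spec.choose_spec.choose_spec.choose_spec.2

variable (w) in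
lemma nonempty (M : C) : Nonempty (w.PostnikovTower M) := by
  have h (n : ℤ) := w.exists_decomposition_le M (-n) (-n + 1) rfl
  choose L R f g k hT hL hR using h
  exact ⟨ofDecompositions L f hL (fun n => ⟨R n, g n, k n, hT n, hR n⟩)⟩

/-- Transport of a Postnikov tower along an isomorphism. -/
def ofIso {M M' : C} (T : w.PostnikovTower M) (e : M ≅ M') : w.PostnikovTower M' where
  obj := T.obj
  toObj n := T.toObj n ≫ e.hom
  isLE := T.isLE
  isGE n := by
    obtain ⟨R, g, h, hT, hR⟩ := T.isGE n
    exact ⟨R, e.inv ≫ g, h, distTriang_mk_of_iso₂ hT e, hR⟩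
  map := T.map
  comm n := by rw [← T.comm, assoc]
  factor := T.factor
  π := T.π
  δ := T.δ
  distinguished := T.distinguished

/-- If M = 0, each `T.obj n` is a shift of the upper part by -1, so it has weights ≥ -n and receives
no nonzero map from `T.obj (n + 1)`. -/
lemma exists_splitting_of_isZero {M : C} (T : w.PostnikovTower M) (hM : IsZero M) (n : ℤ) :
    ∃ (r : T.factor n ⟶ T.obj n) (s : (T.obj (n + 1))⟦(1 : ℤ)⟧ ⟶ T.factor n),
      T.π n ≫ r = 𝟙 _ ∧ s ≫ T.δ n = 𝟙 _ ∧ r ≫ T.π n + T.δ n ≫ s = 𝟙 _ := by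
  have h₀ : T.map n = 0 := by
    obtain ⟨R, g, h, hT, hR⟩ := T.isGE n
    have hge : w.IsGE (-n) (T.obj n) :=
      IsGE.ext₁ hT rfl (isGE_of_isZero (-n) hM) hR
    exact (T.isLE (n + 1)).hom_eq_zero hge (by lia) _
  exact exists_splitting_of_distTriang (rotate_distTriang_mk (T.distinguished n))
    (by rw [h₀]; simp)

variable [IsTriangulated C]

/-- By the splittings, factor n is `T.obj n` ⊕ `T.obj (n + 1)`[1], and the differential identifies
the second summand in one degree with the first summand in the next. Going back along these
identifications is a contraction. -/
lemma isZero_complex {M : C} (T : w.PostnikovTower M) (hM : IsZero M) :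
    IsZero ((HomotopyCategory.quotient w.Heart (ComplexShape.up ℤ)).obj T.complex) := by
  choose r s h₁ h₂ h₃ using T.exists_splitting_of_isZero hM
  let e (n : ℤ) (A : C) := (shiftFunctorAdd' C 1 n (n + 1) (add_comm 1 n)).app A
  rw [HomotopyCategory.isZero_quotient_obj_iff]
  refine ⟨homotopyIdZero (fun n => ObjectProperty.homMk
    ((r (n + 1))⟦n + 1⟧' ≫ (e n _).hom ≫ (s n)⟦n⟧')) (fun n => ?_)⟩
  rw [complex_d, complex_d]
  ext
  change ((r (n + 1))⟦n + 1⟧' ≫ (e n _).hom ≫ (s n)⟦n⟧') ≫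
    shiftHomSucc n (T.δ n ≫ (T.π (n + 1))⟦(1 : ℤ)⟧') +
    shiftHomSucc (n + 1) (T.δ (n + 1) ≫ (T.π (n + 1 + 1))⟦(1 : ℤ)⟧') ≫
      (r (n + 1 + 1))⟦n + 1 + 1⟧' ≫ (e (n + 1) _).hom ≫ (s (n + 1))⟦n + 1⟧' =
      𝟙 ((T.factor (n + 1))⟦n + 1⟧)
  have a₁ : (s n)⟦n⟧' ≫ shiftHomSucc n (T.δ n ≫ (T.π (n + 1))⟦(1 : ℤ)⟧') =
      (e n _).inv ≫ (T.π (n + 1))⟦n + 1⟧' := by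
    rw [map_comp_shiftHomSucc, reassoc_of% h₂ n]
    exact (shiftFunctorAdd' C 1 n (n + 1) (add_comm 1 n)).inv.naturality (T.π (n + 1))
  have a₂ : shiftHomSucc (n + 1) (T.δ (n + 1) ≫ (T.π (n + 1 + 1))⟦(1 : ℤ)⟧') ≫
      (r (n + 1 + 1))⟦n + 1 + 1⟧' = (T.δ (n + 1))⟦n + 1⟧' ≫ (e (n + 1) _).inv := by
    rw [shiftHomSucc_comp_map, assoc, ← Functor.map_comp, h₁, CategoryTheory.Functor.map_id,
      comp_id]
    rfl
  rw [reassoc_of% a₂, Iso.inv_hom_id_assoc, assoc, assoc, a₁, Iso.hom_inv_id_assoc,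
    ← Functor.map_comp, ← Functor.map_comp, ← Functor.map_add, h₃, CategoryTheory.Functor.map_id]

/-- Weak exactness for M = M → 0 allows different towers at the two copies of M; the third complex
is contractible, so the first map is an isomorphism. -/
lemma nonempty_complex_iso {M : C} (T T' : w.PostnikovTower M) :
    Nonempty ((HomotopyCategory.quotient w.Heart (ComplexShape.up ℤ)).obj T.complex ≅
      (HomotopyCategory.quotient w.Heart (ComplexShape.up ℤ)).obj T'.complex) := by
  obtain ⟨T₀, a, b, c, hd⟩ := exists_distTriang_complex (contractible_distinguished M) T T'
  have : IsIso a := (Triangle.isZero₃_iff_isIso₁ _ hd).1 (T₀.isZero_complex (isZero_zero C))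
  exact ⟨asIso a⟩

end PostnikovTower

end WeightStructure

end Weights

end

/-! ### Complexes over `B` representing weight complexes. -/

noncomputable section

namespace Weights

namespace WeightStructure

variable {C : Type u} [Category.{v} C] [HasZeroObject C] [HasShift C ℤ] [Preadditive C]
  [∀ n : ℤ, (shiftFunctor C n).Additive] [Pretriangulated C] [IsTriangulated C]
  {w : WeightStructure C} {B : ObjectProperty C} {hB : B ≤ w.heart}

lemma isModel_iff {M : C} {X : CochainComplex B.FullSubcategory ℤ} :
    w.IsModel hB M X ↔ ∃ T : w.PostnikovTower M,
      Nonempty (((ObjectProperty.ιOfLE hB).mapHomotopyCategory (ComplexShape.up ℤ)).obj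
        ((HomotopyCategory.quotient _ _).obj X) ≅ (HomotopyCategory.quotient _ _).obj T.complex) := by
  constructor
  · rintro ⟨K, hK, ⟨e⟩⟩
    obtain ⟨T, ⟨e'⟩⟩ := hK.exists_iso
    exact ⟨T, ⟨HomotopyCategory.isoOfHomotopyEquiv e ≪≫
      (HomotopyCategory.quotient _ _).mapIso e'⟩⟩
  · rintro ⟨T, ⟨e⟩⟩
    exact ⟨T.complex, T.isWeightComplex_complex, ⟨HomotopyCategory.homotopyEquivOfIso e⟩⟩

namespace IsModel

variable {M M' : C} {X X' : CochainComplex B.FullSubcategory ℤ}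

lemma iso_tower (h : w.IsModel hB M X) (T : w.PostnikovTower M) :
    Nonempty (((ObjectProperty.ιOfLE hB).mapHomotopyCategory (ComplexShape.up ℤ)).obj
        ((HomotopyCategory.quotient _ _).obj X) ≅
          (HomotopyCategory.quotient _ _).obj T.complex) := by
  obtain ⟨T', ⟨e⟩⟩ := isModel_iff.1 h
  obtain ⟨e'⟩ := T'.nonempty_complex_iso T
  exact ⟨e ≪≫ e'⟩

lemma of_iso_obj (h : w.IsModel hB M X) (e : M ≅ M') : w.IsModel hB M' X := by
  obtain ⟨T, ⟨e'⟩⟩ := isModel_iff.1 h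
  exact isModel_iff.2 ⟨T.ofIso e, ⟨e'⟩⟩

/-- Fullness of B in Hw makes K(B) → K(Hw) fully faithful, so the equivalence lives over B, where F
can be applied to it. -/
lemma unique (h : w.IsModel hB M X) (h' : w.IsModel hB M X') :
    Nonempty ((HomotopyCategory.quotient _ (ComplexShape.up ℤ)).obj X ≅
      (HomotopyCategory.quotient _ _).obj X') := by
  obtain ⟨T, ⟨e⟩⟩ := isModel_iff.1 h
  obtain ⟨e'⟩ := h'.iso_tower T
  exact ⟨((ObjectProperty.ιOfLE hB).mapHomotopyCategory (ComplexShape.up ℤ)).preimageIso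
    (e ≪≫ e'.symm)⟩

variable [HasZeroObject B.FullSubcategory] [HasBinaryBiproducts B.FullSubcategory]

/-- Models of a cone are given by mapping cones. -/
lemma exists_mappingCone {W Y : C} {f : W ⟶ M} {g : M ⟶ Y} {k : Y ⟶ W⟦(1 : ℤ)⟧}
    (hT : Triangle.mk f g k ∈ distTriang C) {KW KM : CochainComplex B.FullSubcategory ℤ}
    (hW : w.IsModel hB W KW) (hM : w.IsModel hB M KM) :
    ∃ φ : KW ⟶ KM, w.IsModel hB Y (CochainComplex.mappingCone φ) := by
  obtain ⟨TW, ⟨eW⟩⟩ := isModel_iff.1 hW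
  obtain ⟨TM, ⟨eM⟩⟩ := isModel_iff.1 hM
  obtain ⟨TY, a, b, c, hd⟩ := PostnikovTower.exists_distTriang_complex hT TW TM
  let Φ := (ObjectProperty.ιOfLE hB).mapHomotopyCategory (ComplexShape.up ℤ)
  -- The map of weight complexes is lifted to K(B), then to an actual chain map. Its mapping cone
  -- and t(Y) complete isomorphic morphisms to distinguished triangles.
  obtain ⟨ψ, hψ⟩ := Φ.map_surjective (eW.hom ≫ a ≫ eM.inv)
  obtain ⟨φ, rfl⟩ := (HomotopyCategory.quotient _ (ComplexShape.up ℤ)).map_surjective ψ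
  have h₁ := Φ.map_distinguished _ (HomotopyCategory.mappingCone_triangleh_distinguished φ)
  refine ⟨φ, isModel_iff.2 ⟨TY, ⟨Triangle.π₃.mapIso (isoTriangleOfIso₁₂ _ _ h₁ hd eW eM ?_)⟩⟩⟩
  change Φ.map ((HomotopyCategory.quotient _ (ComplexShape.up ℤ)).map φ) ≫ eM.hom = eW.hom ≫ a
  rw [hψ]
  simp

lemma exists_distTriang {W Y : C} {f : W ⟶ M} {g : M ⟶ Y} {k : Y ⟶ W⟦(1 : ℤ)⟧}
    (hT : Triangle.mk f g k ∈ distTriang C) {KW KM KY : CochainComplex B.FullSubcategory ℤ}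
    (hW : w.IsModel hB W KW) (hM : w.IsModel hB M KM) (hY : w.IsModel hB Y KY) :
    ∃ (a : (HomotopyCategory.quotient _ (ComplexShape.up ℤ)).obj KW ⟶
        (HomotopyCategory.quotient _ _).obj KM)
      (b : (HomotopyCategory.quotient _ (ComplexShape.up ℤ)).obj KM ⟶
        (HomotopyCategory.quotient _ _).obj KY)
      (c : (HomotopyCategory.quotient _ (ComplexShape.up ℤ)).obj KY ⟶
        ((HomotopyCategory.quotient _ (ComplexShape.up ℤ)).obj KW)⟦(1 : ℤ)⟧),
      Triangle.mk a b c ∈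
        distTriang (HomotopyCategory B.FullSubcategory (ComplexShape.up ℤ)) := by
  obtain ⟨φ, hφ⟩ := exists_mappingCone hT hW hM
  obtain ⟨e⟩ := hφ.unique hY
  have h := HomotopyCategory.mappingCone_triangleh_distinguished φ
  obtain ⟨b, c, hbc⟩ := exists_distTriang_of_iso₃ h e
  exact ⟨_, b, c, hbc⟩

end IsModel

end WeightStructure

end Weights

end

/-! ### Weight complexes of shifts and of objects of the heart. -/

noncomputable section

namespace Weights

section Single

variable {V : Type u} [Category.{v} V] [Preadditive V] [HasZeroObject V]

lemma nonempty_iso_single {K : CochainComplex V ℤ} {A : V} (hK : ∀ n : ℤ, n ≠ 0 → IsZero (K.X n))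
    (e : K.X 0 ≅ A) :
    Nonempty (K ≅ (HomologicalComplex.single V (ComplexShape.up ℤ) 0).obj A) := by
  let f : K ⟶ (HomologicalComplex.single V (ComplexShape.up ℤ) 0).obj A :=
    HomologicalComplex.mkHomToSingle e.hom (fun i hi => (hK i (by
      have : i + 1 = 0 := hi
      lia)).eq_of_src _ _)
  have (n : ℤ) : IsIso (f.f n) := by
    by_cases hn : n = 0
    · subst hn
      rw [HomologicalComplex.mkHomToSingle_f]
      infer_instance
    · rw [(hK n hn).eq_of_src (f.f n)
        ((hK n hn).iso (HomologicalComplex.isZero_single_obj_X _ 0 A n hn)).hom]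
      infer_instance
  have := HomologicalComplex.Hom.isIso_of_components f
  exact ⟨asIso f⟩

end Single

namespace WeightStructure

variable {C : Type u} [Category.{v} C] [HasZeroObject C] [HasShift C ℤ] [Preadditive C]
  [∀ n : ℤ, (shiftFunctor C n).Additive] [Pretriangulated C] {w : WeightStructure C}

lemma exists_decomposition_heart {N : C} (hN : w.heart N) (n : ℤ) :
    ∃ (L R : C) (f : L ⟶ N) (g : N ⟶ R) (h : R ⟶ L⟦(1 : ℤ)⟧),
      Triangle.mk f g h ∈ distTriang C ∧ w.IsLE (-n) L ∧ w.IsGE (-n + 1) R ∧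
      (n ≤ 0 → IsIso f) ∧ (0 < n → IsZero L) := by
  rcases le_or_gt n 0 with hn | hn
  · exact ⟨N, _, 𝟙 N, _, _, contractible_distinguished N, (isLE_zero_iff.2 hN.1).mono (by lia),
      isGE_of_isZero _ (isZero_zero C), fun _ => inferInstance, fun _ => by lia⟩
  · exact ⟨_, N, _, 𝟙 N, _, contractible_distinguished₁ N, isLE_of_isZero _ (isZero_zero C),
      (isGE_zero_iff.2 hN.2).mono (by lia), fun _ => by lia, fun _ => isZero_zero C⟩

variable [IsTriangulated C]

namespace PostnikovTower

lemma nonempty_complex_iso_of_iso {M M' : C} (T : w.PostnikovTower M) (T' : w.PostnikovTower M')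
    (e : M ≅ M') :
    Nonempty ((HomotopyCategory.quotient w.Heart (ComplexShape.up ℤ)).obj T.complex ≅
      (HomotopyCategory.quotient w.Heart (ComplexShape.up ℤ)).obj T'.complex) :=
  (T.ofIso e).nonempty_complex_iso T'

-- Weak exactness for M → 0 → M[1]: the middle complex is contractible, so the connecting morphism
-- is an isomorphism.
open ZeroObject in
lemma nonempty_complex_iso_shift_one {M : C} (T : w.PostnikovTower M)
    (T' : w.PostnikovTower (M⟦(1 : ℤ)⟧)) :
    Nonempty ((HomotopyCategory.quotient w.Heart (ComplexShape.up ℤ)).obj T'.complex ≅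
      ((HomotopyCategory.quotient w.Heart (ComplexShape.up ℤ)).obj T.complex)⟦(1 : ℤ)⟧) := by
  obtain ⟨T₀⟩ := PostnikovTower.nonempty w (0 : C)
  obtain ⟨T₁, a, b, c, hd⟩ := exists_distTriang_complex (contractible_distinguished₂ M) T T₀
  have : IsIso c := (Triangle.isZero₂_iff_isIso₃ _ hd).1 (T₀.isZero_complex (isZero_zero C))
  obtain ⟨e⟩ := T'.nonempty_complex_iso T₁
  exact ⟨e ≪≫ asIso c⟩

lemma nonempty_complex_iso_shift {M : C} (T : w.PostnikovTower M) (n : ℤ)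
    (T' : w.PostnikovTower (M⟦n⟧)) :
    Nonempty ((HomotopyCategory.quotient w.Heart (ComplexShape.up ℤ)).obj T'.complex ≅
      ((HomotopyCategory.quotient w.Heart (ComplexShape.up ℤ)).obj T.complex)⟦n⟧) := by
  induction n with
  | zero =>
    obtain ⟨e⟩ := T'.nonempty_complex_iso_of_iso T ((shiftFunctorZero C ℤ).app M)
    exact ⟨e ≪≫ ((shiftFunctorZero _ ℤ).app _).symm⟩
  | succ n hn =>
    obtain ⟨T₁⟩ := PostnikovTower.nonempty w (M⟦(n : ℤ)⟧)
    obtain ⟨T₂⟩ := PostnikovTower.nonempty w (M⟦(n : ℤ)⟧⟦(1 : ℤ)⟧)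
    obtain ⟨e₁⟩ := hn T₁
    obtain ⟨e₂⟩ := T₁.nonempty_complex_iso_shift_one T₂
    obtain ⟨e₃⟩ := T'.nonempty_complex_iso_of_iso T₂ ((shiftFunctorAdd C (n : ℤ) 1).app M)
    exact ⟨e₃ ≪≫ e₂ ≪≫ (shiftFunctor _ (1 : ℤ)).mapIso e₁ ≪≫
      ((shiftFunctorAdd _ (n : ℤ) 1).app _).symm⟩
  | pred n hn =>
    obtain ⟨T₁⟩ := PostnikovTower.nonempty w (M⟦-(n : ℤ)⟧)
    obtain ⟨T₂⟩ := PostnikovTower.nonempty w (M⟦-(n : ℤ) - 1⟧⟦(1 : ℤ)⟧)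
    obtain ⟨e₁⟩ := hn T₁
    obtain ⟨e₂⟩ := T'.nonempty_complex_iso_shift_one T₂
    obtain ⟨e₃⟩ := T₂.nonempty_complex_iso_of_iso T₁
      ((shiftFunctorAdd' C (-(n : ℤ) - 1) 1 (-n) (by lia)).app M).symm
    -- Downward induction compares the complexes after one more shift by 1, which is then cancelled
    -- by full faithfulness.
    exact ⟨(shiftFunctor _ (1 : ℤ)).preimageIso (e₂.symm ≪≫ e₃ ≪≫ e₁ ≪≫
      (shiftFunctorAdd' _ (-(n : ℤ) - 1) 1 (-n) (by lia)).app _)⟩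

end PostnikovTower

/-- The decompositions N = N → 0 for n ≤ 0 and 0 → N = N for n > 0 give a tower whose only nonzero
factor can be the one of index 0, namely N. -/
lemma exists_tower_heart {N : C} (hN : w.heart N) :
    ∃ T : w.PostnikovTower N, Nonempty (T.complex ≅
      (HomologicalComplex.single w.Heart (ComplexShape.up ℤ) 0).obj ⟨N, hN⟩) := by
  choose L R f g k hT hL hR h₁ h₂ using exists_decomposition_heart hN
  let T : w.PostnikovTower N :=
    PostnikovTower.ofDecompositions L f hL (fun n => ⟨R n, g n, k n, hT n, hR n⟩)
  have hF (n : ℤ) (hn : n ≠ 0) : IsZero (T.factor n) := by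
    rcases lt_or_gt_of_ne hn with hn | hn
    · have i₁ : IsIso (T.toObj n) := h₁ n (by lia)
      have i₂ : IsIso (T.toObj (n + 1)) := h₁ (n + 1) (by lia)
      have : IsIso (T.map n) := by
        have : IsIso (T.map n ≫ T.toObj n) := by rw [T.comm]; exact i₂
        exact IsIso.of_isIso_comp_right _ (T.toObj n)
      exact Triangle.isZero₃_of_isIso₁ _ (T.distinguished n) this
    · exact Triangle.isZero₃_of_isZero₁₂ _ (T.distinguished n) (h₂ (n + 1) (by lia))
        (h₂ n (by lia))
  have i₀ : IsIso (T.π 0) :=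
    (Triangle.isZero₁_iff_isIso₂ _ (T.distinguished 0)).1 (h₂ (0 + 1) (by lia))
  have i₁ : IsIso (T.toObj 0) := h₁ 0 le_rfl
  let e : T.X 0 ≅ N := (shiftFunctorZero C ℤ).app _ ≪≫ (asIso (T.π 0)).symm ≪≫ asIso (T.toObj 0)
  refine ⟨T, nonempty_iso_single (fun n hn => ?_) (w.heart.fullyFaithfulι.preimageIso e)⟩
  rw [IsZero.iff_id_eq_zero]
  ext
  exact ((shiftFunctor C n).map_isZero (hF n hn)).eq_of_src _ _

variable {B : ObjectProperty C} {hB : B ≤ w.heart}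

lemma isModel_single [HasZeroObject B.FullSubcategory] (b : B.FullSubcategory) :
    w.IsModel hB b.obj ((HomologicalComplex.single _ (ComplexShape.up ℤ) 0).obj b) := by
  obtain ⟨T, ⟨e⟩⟩ := exists_tower_heart (hB _ b.property)
  obtain ⟨e'⟩ := nonempty_iso_single
    (K := ((ObjectProperty.ιOfLE hB).mapHomologicalComplex (ComplexShape.up ℤ)).obj
      ((HomologicalComplex.single _ (ComplexShape.up ℤ) 0).obj b))
    (fun n hn => (ObjectProperty.ιOfLE hB).map_isZero
      (HomologicalComplex.isZero_single_obj_X _ 0 b n hn))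
    ((ObjectProperty.ιOfLE hB).mapIso (HomologicalComplex.singleObjXSelf _ 0 b))
  exact isModel_iff.2 ⟨T, ⟨(HomotopyCategory.quotient _ _).mapIso (e' ≪≫ e.symm)⟩⟩

lemma IsModel.shift [HasZeroObject B.FullSubcategory] [HasBinaryBiproducts B.FullSubcategory]
    {M : C} {X : CochainComplex B.FullSubcategory ℤ} (h : w.IsModel hB M X) (n : ℤ) :
    w.IsModel hB (M⟦n⟧) (X⟦n⟧) := by
  obtain ⟨T, ⟨e⟩⟩ := isModel_iff.1 h
  obtain ⟨T'⟩ := PostnikovTower.nonempty w (M⟦n⟧)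
  obtain ⟨e'⟩ := T.nonempty_complex_iso_shift n T'
  let Φ := (ObjectProperty.ιOfLE hB).mapHomotopyCategory (ComplexShape.up ℤ)
  exact isModel_iff.2 ⟨T', ⟨Φ.mapIso
    (((HomotopyCategory.quotient _ (ComplexShape.up ℤ)).commShiftIso n).app X) ≪≫
    (Φ.commShiftIso n).app _ ≪≫ (shiftFunctor _ n).mapIso e ≪≫ e'.symm⟩⟩

end WeightStructure

end Weights

end

/-! ### Split Grothendieck groups and Euler characteristics of complexes. -/

noncomputable section

namespace Weights

section K0Add

variable {A : Type u} [Category.{v} A] [Preadditive A] [HasBinaryBiproducts A]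

namespace K0Add

lemma mk_eq_of_iso {X Y : A} (e : X ≅ Y) : mk X = mk Y := by
  dsimp only [mk]
  congr 2
  exact Quotient.sound ⟨e⟩

lemma mk_eq_add {X Y Z : A} (e : Y ≅ X ⊞ Z) : mk Y = mk X + mk Z :=
  (QuotientAddGroup.eq_iff_sub_mem).2 (AddSubgroup.subset_closure ⟨X, Y, Z, ⟨e⟩, rfl⟩)

lemma mk_eq_zero {X : A} (hX : IsZero X) : mk X = 0 := by
  have e : X ≅ X ⊞ X := hX.iso (by
    rw [IsZero.iff_id_eq_zero]
    ext <;> exact hX.eq_of_src _ _)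
  simpa using mk_eq_add e

lemma mk_eq_add_of_splitting {S : ShortComplex A} (s : S.Splitting) :
    mk S.X₂ = mk S.X₁ + mk S.X₃ :=
  mk_eq_add s.isoBinaryBiproduct

/-- The universal property of the split Grothendieck group. -/
def lift {G : Type*} [AddCommGroup G] (f : A → G) (hiso : ∀ X Y : A, (X ≅ Y) → f X = f Y)
    (hf : ∀ X Z : A, f (X ⊞ Z) = f X + f Z) : K0Add A →+ G :=
  QuotientAddGroup.lift _
    (FreeAbelianGroup.lift (Quotient.lift f (fun X Y ⟨e⟩ => hiso X Y e)))
    (by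
      rw [AddSubgroup.closure_le]
      rintro _ ⟨X, Y, Z, ⟨e⟩, rfl⟩
      simp [hiso _ _ e, hf])

@[simp]
lemma lift_mk {G : Type*} [AddCommGroup G] (f : A → G) (hiso : ∀ X Y : A, (X ≅ Y) → f X = f Y)
    (hf : ∀ X Z : A, f (X ⊞ Z) = f X + f Z) (X : A) : lift f hiso hf (mk X) = f X :=
  FreeAbelianGroup.lift_apply_of _ _

lemma hom_ext {G : Type*} [AddCommGroup G] {φ ψ : K0Add A →+ G}
    (h : ∀ X : A, φ (mk X) = ψ (mk X)) : φ = ψ :=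
  QuotientAddGroup.addMonoidHom_ext _ (FreeAbelianGroup.lift_ext _ _ (fun q =>
    Quotient.inductionOn q h))

lemma hasFiniteBiproducts [HasZeroObject A] : HasFiniteBiproducts A := by
  have := hasFiniteProducts_of_has_binary_and_terminal (C := A)
  exact HasFiniteBiproducts.of_hasFiniteProducts

lemma mk_biproduct [HasFiniteBiproducts A] {J : Type} [Fintype J] (f : J → A) : mk (⨁ f) = ∑ j, mk (f j) := by
  classical
  refine Fintype.induction_empty_option
    (P := fun J _ => ∀ f : J → A, mk (⨁ f) = ∑ j, mk (f j)) ?_ ?_ ?_ J f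
  · intro α β _ e ih f
    let := Fintype.ofEquiv β e.symm
    rw [← Equiv.sum_comp e]
    refine Eq.trans ?_ (ih (f ∘ e))
    exact mk_eq_of_iso (biproduct.whiskerEquiv e (fun _ => Iso.refl _)).symm
  · intro f
    rw [Finset.univ_eq_empty, Finset.sum_empty]
    exact mk_eq_zero ((IsZero.iff_id_eq_zero _).2 (biproduct.hom_ext _ _ (fun j => j.elim)))
  · intro α _ ih f
    rw [Fintype.sum_option, ← ih (fun j => f (some j))]
    refine mk_eq_add
      { hom := biprod.lift (biproduct.π f none) (biproduct.lift (fun j => biproduct.π f (some j)))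
        inv := biprod.desc (biproduct.ι f none) (biproduct.desc (fun j => biproduct.ι f (some j)))
        hom_inv_id := ?_
        inv_hom_id := ?_ }
    · rw [biprod.lift_desc, biproduct.lift_desc, ← biproduct.total, Fintype.sum_option]
    · ext j k <;> simp [biproduct.ι_π]

end K0Add

end K0Add

section Euler

variable {A : Type u} [Category.{v} A] [Preadditive A]

/-- A contracting homotopy can be chosen to have square zero. -/
lemma exists_contraction_sq_zero {Y : CochainComplex A ℤ} (H : Homotopy (𝟙 Y) 0) :
    ∃ s : ∀ p q : ℤ, Y.X p ⟶ Y.X q, (∀ p q, q + 1 ≠ p → s p q = 0) ∧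
      (∀ p q r, q = p + 1 → r + 1 = p → Y.d p q ≫ s q p + s p r ≫ Y.d r p = 𝟙 (Y.X p)) ∧
      ∀ p q r, s p q ≫ s q r = 0 := by
  have hH (p q r : ℤ) (hq : q = p + 1) (hr : r + 1 = p) :
      Y.d p q ≫ H.hom q p + H.hom p r ≫ Y.d r p = 𝟙 (Y.X p) := by
    have := H.comm p
    rw [dNext_eq H.hom (i := p) (i' := q) hq.symm, prevD_eq H.hom (j := p) (j' := r) hr] at this
    simpa using this.symm
  have hd (p q : ℤ) (hq : q = p + 1) : Y.d p q ≫ H.hom q p ≫ Y.d p q = Y.d p q := by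
    have := hH p q (p - 1) hq (by lia) =≫ Y.d p q
    simpa using this
  have hs (p q r : ℤ) (hq : q + 1 = p) (hr : r + 1 = q) :
      Y.d q p ≫ H.hom p q ≫ H.hom q r ≫ Y.d r q = 0 := by
    have h₁ := hH q p r hq.symm hr
    have h₂ : H.hom q r ≫ Y.d r q = 𝟙 _ - Y.d q p ≫ H.hom p q := by
      rw [← h₁]; abel
    rw [h₂]
    have := hd q p hq.symm =≫ H.hom p q
    simp only [Preadditive.comp_sub, comp_id, assoc] at this ⊢
    rw [this, sub_self]
  -- A contraction h is replaced by hdh. It still contracts since dhd = d, and its square vanishes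
  -- since dhhd = 0.
  refine ⟨fun p q => H.hom p q ≫ Y.d q p ≫ H.hom p q, fun p q h => ?_, fun p q r hq hr => ?_,
    fun p q r => ?_⟩
  · simp [H.zero p q h]
  · have h₁ := hd p q hq =≫ H.hom q p
    have h₂ := H.hom p r ≫= hd r p hr.symm
    simp only [assoc] at h₁ h₂ ⊢
    rw [h₁, h₂, hH p q r hq hr]
  · by_cases hq : q + 1 = p
    · by_cases hr : r + 1 = q
      · have := hs p q r hq hr =≫ H.hom q r
        simp only [assoc, zero_comp] at this
        simp only [assoc, this, comp_zero]
      · simp [H.zero q r hr]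
    · simp [H.zero p q hq]

/-- These are the matrix entries of (d + s)² = ds + sd = 1, both squares being zero. Only q = p ± 1
contribute, so `S` may miss these degrees only where the complex vanishes. -/
lemma sum_contraction {Y : CochainComplex A ℤ} {s : ∀ p q : ℤ, Y.X p ⟶ Y.X q}
    (h₀ : ∀ p q, q + 1 ≠ p → s p q = 0)
    (h₁ : ∀ p q r, q = p + 1 → r + 1 = p → Y.d p q ≫ s q p + s p r ≫ Y.d r p = 𝟙 (Y.X p))
    (h₂ : ∀ p q r, s p q ≫ s q r = 0) (S : Finset ℤ) (p r : ℤ)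
    (hS : ∀ q, (q = p + 1 ∨ q + 1 = p) → q ∉ S → IsZero (Y.X q)) :
    ∑ q ∈ S, (Y.d p q + s p q) ≫ (Y.d q r + s q r) =
      if h : p = r then eqToHom (by rw [h]) else 0 := by
  rw [Finset.sum_eq_add (p + 1) (p - 1) (by lia)]
  · have e₁ : s p (p + 1) = 0 := h₀ _ _ (by lia)
    have e₂ : Y.d p (p - 1) = 0 := Y.shape _ _ (by simp; lia)
    rw [e₁, e₂, add_zero, zero_add, Preadditive.comp_add, Preadditive.comp_add, Y.d_comp_d,
      zero_add, h₂, add_zero]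
    split_ifs with h
    · subst h
      exact h₁ p _ _ rfl (by lia)
    · rw [h₀ (p + 1) r (by lia), Y.shape (p - 1) r (by simp; lia)]
      simp
  · rintro q - ⟨hq, hq'⟩
    rw [Y.shape p q (by simp; lia), h₀ p q (by lia)]
    simp
  · intro h
    rw [(hS _ (Or.inl rfl) h).eq_of_src (Y.d (p + 1) r + s (p + 1) r) 0, comp_zero]
  · intro h
    rw [(hS _ (Or.inr (by lia)) h).eq_of_src (Y.d (p - 1) r + s (p - 1) r) 0, comp_zero]

/-- The Euler characteristic of a complex with finitely many nonzero terms. -/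
def eulerChar [HasBinaryBiproducts A] (X : CochainComplex A ℤ) : K0Add A :=
  ∑ᶠ i : ℤ, (i.negOnePow : ℤ) • K0Add.mk (X.X i)

/-- A complex has finite support if almost all of its terms are zero. -/
def HasFiniteSupport (X : CochainComplex A ℤ) : Prop :=
  {i : ℤ | ¬ IsZero (X.X i)}.Finite

variable [HasBinaryBiproducts A]

lemma HasFiniteSupport.support_finite {X : CochainComplex A ℤ} (hX : HasFiniteSupport X) :
    (Function.support (fun i : ℤ => (i.negOnePow : ℤ) • K0Add.mk (X.X i))).Finite :=
  hX.subset (fun i hi h0 => hi (by simp [K0Add.mk_eq_zero h0]))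

lemma HasFiniteSupport.mappingCone {K L : CochainComplex A ℤ} (φ : K ⟶ L)
    (hK : HasFiniteSupport K) (hL : HasFiniteSupport L) :
    HasFiniteSupport (CochainComplex.mappingCone φ) := by
  refine ((hK.preimage (f := fun i => i + 1) (add_left_injective 1).injOn).union hL).subset ?_
  intro i hi
  by_contra h
  simp only [Set.mem_union, Set.mem_preimage, Set.mem_ofPred_eq, not_or, not_not] at h
  refine hi (IsZero.of_iso ?_ (HomologicalComplex.homotopyCofiber.XIsoBiprod φ i (i + 1) rfl))
  rw [IsZero.iff_id_eq_zero]
  ext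
  · exact h.1.eq_of_src _ _
  · exact h.1.eq_of_src _ _
  · exact h.2.eq_of_src _ _
  · exact h.2.eq_of_src _ _

lemma eulerChar_mappingCone {K L : CochainComplex A ℤ} (φ : K ⟶ L)
    (hK : HasFiniteSupport K) (hL : HasFiniteSupport L) :
    eulerChar (CochainComplex.mappingCone φ) = eulerChar L - eulerChar K := by
  have h (i : ℤ) : (i.negOnePow : ℤ) • K0Add.mk ((CochainComplex.mappingCone φ).X i) =
      (i.negOnePow : ℤ) • K0Add.mk (L.X i) -
        ((i + 1).negOnePow : ℤ) • K0Add.mk (K.X (i + 1)) := by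
    have e : K0Add.mk ((CochainComplex.mappingCone φ).X i) = _ :=
      K0Add.mk_eq_add (HomologicalComplex.homotopyCofiber.XIsoBiprod φ i (i + 1) rfl)
    rw [e, Int.negOnePow_succ, smul_add]
    simp [add_comm]
  have hK' : (Function.support
      (fun i : ℤ => ((i + 1).negOnePow : ℤ) • K0Add.mk (K.X (i + 1)))).Finite :=
    hK.support_finite.preimage (f := fun i => i + 1) (add_left_injective 1).injOn
  rw [eulerChar, finsum_congr h, finsum_sub_distrib hL.support_finite hK', eulerChar, eulerChar]
  congr 1
  exact finsum_comp_equiv (Equiv.addRight (1 : ℤ))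
    (f := fun i : ℤ => (i.negOnePow : ℤ) • K0Add.mk (K.X i))

variable [HasZeroObject A]

/-- With a contraction s of square zero, d + s is its own inverse, and it exchanges the sum of the
even terms with the sum of the odd terms. No kernel or image has to exist, so the argument works in
any additive category, even one that is not idempotent complete. -/
lemma eulerChar_eq_zero {Y : CochainComplex A ℤ} (hY : HasFiniteSupport Y)
    (h : IsZero ((HomotopyCategory.quotient A (ComplexShape.up ℤ)).obj Y)) : eulerChar Y = 0 := by
  classical
  have := K0Add.hasFiniteBiproducts (A := A)
  obtain ⟨H⟩ := (HomotopyCategory.isZero_quotient_obj_iff Y).1 h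
  obtain ⟨s, h₀, h₁, h₂⟩ := exists_contraction_sq_zero H
  let S := hY.toFinset
  let S₀ := S.filter Even
  let S₁ := S.filter (fun q => ¬ Even q)
  have hS₀ (q : ℤ) (hq : Even q) (h : q ∉ S₀) : IsZero (Y.X q) := by
    by_contra hq'
    exact h (Finset.mem_filter.2 ⟨hY.mem_toFinset.2 hq', hq⟩)
  have hS₁ (q : ℤ) (hq : ¬ Even q) (h : q ∉ S₁) : IsZero (Y.X q) := by
    by_contra hq'
    exact h (Finset.mem_filter.2 ⟨hY.mem_toFinset.2 hq', hq⟩)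
  have key (S S' : Finset ℤ)
      (hS : ∀ p ∈ S, ∀ q, (q = p + 1 ∨ q + 1 = p) → q ∉ S' → IsZero (Y.X q)) :
      biproduct.matrix (fun (p : S) (q : S') => Y.d p q + s p q) ≫
        biproduct.matrix (fun (q : S') (p : S) => Y.d q p + s q p) =
          𝟙 (⨁ fun p : S => Y.X p) := by
    refine biproduct.hom_ext' _ _ (fun r => biproduct.hom_ext _ _ (fun p => ?_))
    simp only [assoc, biproduct.matrix_π, biproduct.ι_matrix_assoc, biproduct.lift_desc, comp_id]
    rw [Finset.sum_coe_sort S' (fun q : ℤ => (Y.d r q + s r q) ≫ (Y.d q p + s q p)),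
      sum_contraction h₀ h₁ h₂ S' _ _ (hS _ r.2), biproduct.ι_π]
    simp only [Subtype.ext_iff]
  let e : (⨁ fun p : S₀ => Y.X p) ≅ (⨁ fun p : S₁ => Y.X p) :=
    ⟨_, _, key S₀ S₁ (fun p hp q hq => hS₁ q (by
        have := (Finset.mem_filter.1 hp).2
        rcases hq with rfl | rfl
        · simpa [Int.even_add_one] using this
        · simpa [Int.even_add_one] using this)),
      key S₁ S₀ (fun p hp q hq => hS₀ q (by
        have := (Finset.mem_filter.1 hp).2
        rcases hq with rfl | rfl
        · simpa [Int.even_add_one] using this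
        · simpa [Int.even_add_one] using this))⟩
  have he := K0Add.mk_eq_of_iso e
  rw [K0Add.mk_biproduct, K0Add.mk_biproduct,
    Finset.sum_coe_sort S₀ (fun q => K0Add.mk (Y.X q)),
    Finset.sum_coe_sort S₁ (fun q => K0Add.mk (Y.X q))] at he
  rw [eulerChar, finsum_eq_sum_of_support_subset (s := S),
    ← Finset.sum_filter_add_sum_filter_not S Even]
  · have e₀ : ∑ i ∈ S.filter Even, (i.negOnePow : ℤ) • K0Add.mk (Y.X i) =
        ∑ i ∈ S₀, K0Add.mk (Y.X i) := Finset.sum_congr rfl (fun i hi => by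
      rw [Int.negOnePow_even _ (Finset.mem_filter.1 hi).2]; simp)
    have e₁ : ∑ i ∈ S.filter (fun q => ¬ Even q), (i.negOnePow : ℤ) • K0Add.mk (Y.X i) =
        - ∑ i ∈ S₁, K0Add.mk (Y.X i) := by
      rw [← Finset.sum_neg_distrib]
      exact Finset.sum_congr rfl (fun i hi => by
        rw [Int.negOnePow_odd _ (Int.not_even_iff_odd.1 (Finset.mem_filter.1 hi).2)]; simp)
    rw [e₀, e₁, he, add_neg_cancel]
  · intro i hi
    refine hY.mem_toFinset.2 (fun h0 => hi ?_)
    simp [K0Add.mk_eq_zero h0]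

/-- The mapping cone of a homotopy equivalence is contractible, and its Euler characteristic is the
difference of the two. -/
lemma eulerChar_eq_of_iso {K L : CochainComplex A ℤ} (hK : HasFiniteSupport K)
    (hL : HasFiniteSupport L)
    (e : (HomotopyCategory.quotient A (ComplexShape.up ℤ)).obj K ≅
      (HomotopyCategory.quotient A (ComplexShape.up ℤ)).obj L) : eulerChar K = eulerChar L := by
  obtain ⟨φ, hφ⟩ := (HomotopyCategory.quotient A (ComplexShape.up ℤ)).map_surjective e.hom
  have h := Triangle.isZero₃_of_isIso₁ _
    (HomotopyCategory.mappingCone_triangleh_distinguished φ)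
      (by change IsIso ((HomotopyCategory.quotient A (ComplexShape.up ℤ)).map φ)
          rw [hφ]; infer_instance)
  have := eulerChar_eq_zero (hK.mappingCone φ hL) h
  rw [eulerChar_mappingCone φ hK hL] at this
  exact (sub_eq_zero.1 this).symm

end Euler

end Weights

end

/-! ### Triangulated Grothendieck groups and the homomorphism F_{K_0}. -/

noncomputable section

namespace Weights

section

variable {T : Type u} [Category.{v} T] [HasZeroObject T] [HasShift T ℤ] [Preadditive T]
  [∀ n : ℤ, (shiftFunctor T n).Additive] [Pretriangulated T]

namespace K0Tr

lemma mk_eq_of_iso {X Y : T} (e : X ≅ Y) : mk X = mk Y := by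
  dsimp only [mk]
  congr 2
  exact Quotient.sound ⟨e⟩

lemma mk_eq_add {X Y Z : T} {f : X ⟶ Y} {g : Y ⟶ Z} {h : Z ⟶ X⟦(1 : ℤ)⟧}
    (hT : Triangle.mk f g h ∈ distTriang T) : mk Y = mk X + mk Z :=
  (QuotientAddGroup.eq_iff_sub_mem).2 (AddSubgroup.subset_closure ⟨X, Y, Z, f, g, h, hT, rfl⟩)

lemma mk_eq_zero {X : T} (hX : IsZero X) : mk X = 0 := by
  have h := mk_eq_add (contractible_distinguished X)
  rw [mk_eq_of_iso ((isZero_zero T).iso hX)] at h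
  simpa using h

lemma mk_shift_one (X : T) : mk (X⟦(1 : ℤ)⟧) = - mk X := by
  have h := mk_eq_add (contractible_distinguished₂ X)
  rw [mk_eq_zero (isZero_zero T)] at h
  exact (neg_eq_of_add_eq_zero_right h.symm).symm

lemma mk_shift (X : T) (n : ℤ) : mk (X⟦n⟧) = (n.negOnePow : ℤ) • mk X := by
  induction n with
  | zero => simpa using mk_eq_of_iso ((shiftFunctorZero T ℤ).app X)
  | succ n hn =>
    rw [mk_eq_of_iso ((shiftFunctorAdd T (n : ℤ) 1).app X)]
    refine (mk_shift_one _).trans ?_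
    rw [hn, Int.negOnePow_succ]
    simp
  | pred n hn =>
    rw [mk_eq_of_iso ((shiftFunctorAdd' T (-(n : ℤ) - 1) 1 (-n) (by lia)).app X)] at hn
    have h := (mk_shift_one _).symm.trans hn
    rw [Int.negOnePow_sub, Int.negOnePow_one]
    simpa [neg_eq_iff_eq_neg] using h

/-- The universal property of the Grothendieck group of a triangulated category. -/
def lift {G : Type*} [AddCommGroup G] (f : T → G) (hiso : ∀ X Y : T, (X ≅ Y) → f X = f Y)
    (hf : ∀ (X Y Z : T) (a : X ⟶ Y) (b : Y ⟶ Z) (c : Z ⟶ X⟦(1 : ℤ)⟧),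
      Triangle.mk a b c ∈ distTriang T → f Y = f X + f Z) : K0Tr T →+ G :=
  QuotientAddGroup.lift _
    (FreeAbelianGroup.lift (Quotient.lift f (fun X Y ⟨e⟩ => hiso X Y e)))
    (by
      rw [AddSubgroup.closure_le]
      rintro _ ⟨X, Y, Z, a, b, c, h, rfl⟩
      simp [hf _ _ _ _ _ _ h])

@[simp]
lemma lift_mk {G : Type*} [AddCommGroup G] (f : T → G) (hiso : ∀ X Y : T, (X ≅ Y) → f X = f Y)
    (hf : ∀ (X Y Z : T) (a : X ⟶ Y) (b : Y ⟶ Z) (c : Z ⟶ X⟦(1 : ℤ)⟧),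
      Triangle.mk a b c ∈ distTriang T → f Y = f X + f Z) (X : T) :
    lift f hiso hf (mk X) = f X :=
  FreeAbelianGroup.lift_apply_of _ _

lemma hom_ext {G : Type*} [AddCommGroup G] {φ ψ : K0Tr T →+ G}
    (h : ∀ X : T, φ (mk X) = ψ (mk X)) : φ = ψ :=
  QuotientAddGroup.addMonoidHom_ext _ (FreeAbelianGroup.lift_ext _ _ (fun q =>
    Quotient.inductionOn q h))

lemma eq_top_of_mk_mem {H : AddSubgroup (K0Tr T)} (h : ∀ X : T, mk X ∈ H) : H = ⊤ := by
  rw [← QuotientAddGroup.ker_mk' H, AddMonoidHom.ker_eq_top_iff]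
  exact hom_ext (fun X => (QuotientAddGroup.eq_zero_iff _).2 (h X))

end K0Tr

end

section Euler

variable {A : Type u} [Category.{v} A] [Preadditive A]

lemma HasFiniteSupport.of_iso {X Y : CochainComplex A ℤ} (hX : HasFiniteSupport X) (e : X ≅ Y) :
    HasFiniteSupport Y :=
  hX.subset (fun i hi h => hi (h.of_iso
    ((HomologicalComplex.eval A (ComplexShape.up ℤ) i).mapIso e.symm)))

lemma HasFiniteSupport.map {A' : Type u₁} [Category.{v₁} A'] [Preadditive A']
    {X : CochainComplex A ℤ} (hX : HasFiniteSupport X) (F : A ⥤ A') [F.Additive] :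
    HasFiniteSupport ((F.mapHomologicalComplex (ComplexShape.up ℤ)).obj X) :=
  hX.subset (fun _ hi h => hi (F.map_isZero h))

lemma HasFiniteSupport.shift {X : CochainComplex A ℤ} (hX : HasFiniteSupport X) (n : ℤ) :
    HasFiniteSupport (X⟦n⟧) :=
  hX.preimage (f := fun i => i + n) (add_left_injective n).injOn

lemma hasFiniteSupport_of_isZero {X : CochainComplex A ℤ} (h : ∀ n : ℤ, n ≠ 0 → IsZero (X.X n)) :
    HasFiniteSupport X :=
  (Set.finite_singleton (0 : ℤ)).subset (fun i hi => by
    by_contra hi'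
    exact hi (h i hi'))

lemma eulerChar_of_isZero [HasBinaryBiproducts A] {X : CochainComplex A ℤ}
    (h : ∀ n : ℤ, n ≠ 0 → IsZero (X.X n)) : eulerChar X = K0Add.mk (X.X 0) := by
  rw [eulerChar, finsum_eq_single _ (0 : ℤ) (fun n hn => by simp [K0Add.mk_eq_zero (h n hn)])]
  simp

end Euler

namespace WeightStructure

variable {C : Type u} [Category.{v} C] [HasZeroObject C] [HasShift C ℤ] [Preadditive C]
  [∀ n : ℤ, (shiftFunctor C n).Additive] [Pretriangulated C] [IsTriangulated C]
  {w : WeightStructure C} {B : ObjectProperty C} {hB : B ≤ w.heart}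

lemma IsModel.eulerChar_eq {A : Type u₂} [Category.{v₂} A] [Preadditive A] [HasZeroObject A]
    [HasBinaryBiproducts A] {F : B.FullSubcategory ⥤ A} [F.Additive] {M : C}
    {X X' : CochainComplex B.FullSubcategory ℤ} (h : w.IsModel hB M X) (h' : w.IsModel hB M X')
    (hX : FinitelySupported F X) (hX' : FinitelySupported F X') :
    eulerChar ((F.mapHomologicalComplex (ComplexShape.up ℤ)).obj X) =
      eulerChar ((F.mapHomologicalComplex (ComplexShape.up ℤ)).obj X') := by
  obtain ⟨e⟩ := h.unique h'
  exact eulerChar_eq_of_iso hX hX' ((F.mapHomotopyCategory (ComplexShape.up ℤ)).mapIso e)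

variable [HasZeroObject B.FullSubcategory]

section

variable {T : Type u₁} [Category.{v₁} T] [HasZeroObject T] [HasShift T ℤ] [Preadditive T]
  [∀ n : ℤ, (shiftFunctor T n).Additive] [Pretriangulated T] {ι : T ⥤ C}

lemma IsEulerHom.map_mk_heart {A : Type u₂} [Category.{v₂} A] [Preadditive A]
    [HasBinaryBiproducts A] {F : B.FullSubcategory ⥤ A} [F.Additive] {φ : K0Tr T →+ K0Add A}
    (hφ : w.IsEulerHom hB ι F φ) {M : T} {b : B.FullSubcategory} (e : b.obj ≅ ι.obj M) :
    φ (K0Tr.mk M) = K0Add.mk (F.obj b) := by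
  let S := (HomologicalComplex.single B.FullSubcategory (ComplexShape.up ℤ) 0).obj b
  have h₀ (n : ℤ) (hn : n ≠ 0) :
      IsZero (((F.mapHomologicalComplex (ComplexShape.up ℤ)).obj S).X n) :=
    F.map_isZero (HomologicalComplex.isZero_single_obj_X _ 0 b n hn)
  rw [hφ M S ((isModel_single b).of_iso_obj e) (hasFiniteSupport_of_isZero h₀)]
  exact (eulerChar_of_isZero h₀).trans
    (K0Add.mk_eq_of_iso (F.mapIso (HomologicalComplex.singleObjXSelf _ 0 b)))

variable [HasBinaryBiproducts B.FullSubcategory]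

/-- The Euler characteristic of weight complexes is a well-defined homomorphism. -/
lemma IsFinite.existsUnique_isEulerHom [ι.CommShift ℤ] [ι.IsTriangulated]
    {A : Type u₂} [Category.{v₂} A] [Preadditive A] [HasZeroObject A]
    [HasBinaryBiproducts A] {F : B.FullSubcategory ⥤ A} [F.Additive] (h : w.IsFinite hB ι F) :
    ∃! φ : K0Tr T →+ K0Add A, w.IsEulerHom hB ι F φ := by
  choose X hX hXF using h
  let Φ := F.mapHomologicalComplex (ComplexShape.up ℤ)
  let φ : K0Tr T →+ K0Add A := K0Tr.lift (fun M => eulerChar (Φ.obj (X M)))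
    (fun M M' e => (hX M).of_iso_obj (ι.mapIso e) |>.eulerChar_eq (hX M') (hXF _) (hXF _))
    (fun M M' M'' a b c hT => by
      obtain ⟨f, hf⟩ := IsModel.exists_mappingCone (ι.map_distinguished _ hT) (hX M) (hX M')
      -- An additive functor commutes with mapping cones, so the model of the third object obtained
      -- as a cone has an F-image with finite support.
      let e := CochainComplex.mappingCone.mapHomologicalComplexIso f F
      have h₁ : HasFiniteSupport (CochainComplex.mappingCone (Φ.map f)) :=
        HasFiniteSupport.mappingCone _ (hXF M) (hXF M')
      have h₂ : HasFiniteSupport (Φ.obj (CochainComplex.mappingCone f)) := h₁.of_iso e.symm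
      have h₃ := hf.eulerChar_eq (F := F) (hX M'') h₂ (hXF M'')
      rw [eulerChar_eq_of_iso h₂ h₁ ((HomotopyCategory.quotient _ _).mapIso e),
        eulerChar_mappingCone (Φ.map f) (show HasFiniteSupport (Φ.obj _) from hXF M)
          (show HasFiniteSupport (Φ.obj _) from hXF M')] at h₃
      rw [← h₃]
      abel)
  have hφ : w.IsEulerHom hB ι F φ := fun M Y hY hYF =>
    (K0Tr.lift_mk _ _ _ M).trans ((hX M).eulerChar_eq hY (hXF M) hYF)
  exact ⟨φ, hφ, fun ψ hψ => K0Tr.hom_ext (fun M =>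
    (hψ M _ (hX M) (hXF M)).trans (hφ M _ (hX M) (hXF M)).symm)⟩

end

end WeightStructure

end Weights

end

/-! ### Strong generation and the comparison of Grothendieck groups. -/

noncomputable section

namespace Weights

variable {C : Type u} [Category.{v} C] [HasZeroObject C] [HasShift C ℤ] [Preadditive C]
  [∀ n : ℤ, (shiftFunctor C n).Additive] [Pretriangulated C] {B : ObjectProperty C}

lemma StronglyGenerates.mono {B' : ObjectProperty C} (h : StronglyGenerates B) (hB : B ≤ B') :
    StronglyGenerates B' :=
  fun P hP hP' hBP => h P hP hP' (hB.trans hBP)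

/-- The homomorphism from the split Grothendieck group of a full additive subcategory to the
Grothendieck group of the ambient triangulated category. -/
def K0Add.toK0Tr (B : ObjectProperty C) [HasZeroObject B.FullSubcategory]
    [HasBinaryBiproducts B.FullSubcategory] : K0Add B.FullSubcategory →+ K0Tr C :=
  K0Add.lift (fun b => K0Tr.mk b.obj) (fun _ _ e => K0Tr.mk_eq_of_iso (B.ι.mapIso e))
    (fun X Z => have := preservesBinaryBiproducts_of_preservesBiproducts B.ι
      (K0Tr.mk_eq_of_iso (B.ι.mapBiprod X Z)).trans
      (K0Tr.mk_eq_add (binaryBiproductTriangle_distinguished X.obj Z.obj)))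

@[simp]
lemma K0Add.toK0Tr_mk [HasZeroObject B.FullSubcategory]
    [HasBinaryBiproducts B.FullSubcategory] (b : B.FullSubcategory) :
    K0Add.toK0Tr B (K0Add.mk b) = K0Tr.mk b.obj :=
  K0Add.lift_mk _ _ _ b

/-- The objects whose class lies in the image form a strictly full triangulated subcategory
containing B. -/
lemma StronglyGenerates.toK0Tr_surjective [HasZeroObject B.FullSubcategory]
    [HasBinaryBiproducts B.FullSubcategory] (h : StronglyGenerates B) :
    Function.Surjective (K0Add.toK0Tr B) := by
  rw [← AddMonoidHom.range_eq_top]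
  let P : ObjectProperty C := fun M => K0Tr.mk M ∈ (K0Add.toK0Tr B).range
  have : P.IsClosedUnderIsomorphisms := ⟨fun e hX => by
    dsimp only [P]
    rwa [← K0Tr.mk_eq_of_iso e]⟩
  have : P.IsStableUnderShift ℤ := ⟨fun n => ⟨fun X hX => by
    change K0Tr.mk (X⟦n⟧) ∈ _
    rw [K0Tr.mk_shift]
    exact AddSubgroup.zsmul_mem _ hX _⟩⟩
  have : P.ContainsZero := ⟨⟨_, isZero_zero C, by
    dsimp only [P]
    rw [K0Tr.mk_eq_zero (isZero_zero C)]
    exact zero_mem _⟩⟩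
  have : P.IsTriangulatedClosed₂ := .mk' (fun T hT h₁ h₃ => by
    dsimp only [P]
    rw [K0Tr.mk_eq_add (f := T.mor₁) (g := T.mor₂) (h := T.mor₃) hT]
    exact add_mem h₁ h₃)
  exact K0Tr.eq_top_of_mk_mem (h P ⟨⟩ inferInstance
    (fun b hb => ⟨K0Add.mk ⟨b, hb⟩, K0Add.toK0Tr_mk _⟩))

namespace WeightStructure

variable {w : WeightStructure C} {hB : B ≤ w.heart}

/-- Induction on the length of an interval [a, a + n] containing the weights of M: a weight
decomposition cuts off the top weight, and an object of a single weight is a shift of an object of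
the heart. -/
lemma IsBounded.stronglyGenerates_heart (hw : w.IsBounded) : StronglyGenerates w.heart := by
  intro P _ _ hP M
  have key (n : ℕ) : ∀ (M : C) (a : ℤ), w.IsGE a M → w.IsLE (a + n) M → P M := by
    induction n with
    | zero =>
      intro M a h₁ h₂
      exact P.prop_of_iso ((shiftFunctorCompIsoId C (-a) a (by lia)).app M)
        (P.le_shift a _ (hP _ (heart_shift (i := a) (by simpa using h₂) h₁ (by lia))))
    | succ n hn =>
      intro M a h₁ h₂
      obtain ⟨L, R, f, g, k, hT, hL, hR⟩ := w.exists_decomposition_le M (a + n) (a + n + 1) rfl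
      refine P.ext_of_isTriangulatedClosed₂ _ hT (hn L a ?_ hL) (hn R (a + 1) ?_ ?_)
      · exact IsGE.ext₁ hT rfl h₁ (hR.mono (by lia))
      · exact hR.mono (by lia)
      · exact IsLE.ext₃ hT (i := a + n) (by lia) hL (h₂.mono (by push_cast; lia))
  obtain ⟨⟨b, hb⟩, ⟨a, ha⟩⟩ := hw M
  -- If b < a, the truncated difference is 0 and the bound b is merely weakened to a.
  exact key (b - a).toNat M a ha (hb.mono (by lia))

variable [IsTriangulated C] [HasZeroObject B.FullSubcategory]
  [HasBinaryBiproducts B.FullSubcategory]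

/-- Objects represented by complexes over B with finite support are closed under shifts and, by
mapping cones, under cones; they contain B, placed in degree 0. -/
lemma isFinite_of_stronglyGenerates (h : StronglyGenerates B) :
    w.IsFinite hB (𝟭 C) (𝟭 B.FullSubcategory) := by
  let P : ObjectProperty C := fun M => ∃ X : CochainComplex B.FullSubcategory ℤ,
    w.IsModel hB M X ∧ HasFiniteSupport X
  have : P.IsClosedUnderIsomorphisms := ⟨fun e ⟨X, hX, hX'⟩ => ⟨X, hX.of_iso_obj e, hX'⟩⟩
  have : P.IsStableUnderShift ℤ := ⟨fun n => ⟨fun M ⟨X, hX, hX'⟩ =>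
    ⟨X⟦n⟧, hX.shift n, hX'.shift n⟩⟩⟩
  have hP (b : B.FullSubcategory) : P b.obj :=
    ⟨_, isModel_single b, hasFiniteSupport_of_isZero (fun n hn =>
      HomologicalComplex.isZero_single_obj_X _ 0 b n hn)⟩
  have : P.ContainsZero := by
    obtain ⟨b, hb⟩ := HasZeroObject.zero (C := B.FullSubcategory)
    exact ⟨⟨b.obj, B.ι.map_isZero hb, hP b⟩⟩
  have : P.IsTriangulatedClosed₃ := .mk' (fun T hT ⟨X₁, h₁, h₁'⟩ ⟨X₂, h₂, h₂'⟩ => by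
    obtain ⟨f, hf⟩ := IsModel.exists_mappingCone (f := T.mor₁) (g := T.mor₂) (k := T.mor₃) hT h₁ h₂
    exact ⟨_, hf, h₁'.mappingCone f h₂'⟩)
  have : P.IsTriangulatedClosed₂ := .of_isTriangulatedClosed₃
  exact h P ⟨⟩ inferInstance (fun b hb => hP ⟨b, hb⟩)

/-- An object of B is its own weight complex, so the Euler characteristic is a left inverse of the
surjection `K0Add.toK0Tr B`. -/
lemma exists_bijective_isEulerHom (h : StronglyGenerates B) :
    ∃ φ : K0Tr C →+ K0Add B.FullSubcategory,
      w.IsEulerHom hB (𝟭 C) (𝟭 B.FullSubcategory) φ ∧ Function.Bijective φ := by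
  obtain ⟨φ, hφ, -⟩ := (isFinite_of_stronglyGenerates (hB := hB) h).existsUnique_isEulerHom
  have h₁ : φ.comp (K0Add.toK0Tr B) = AddMonoidHom.id _ := K0Add.hom_ext (fun b =>
    (congrArg φ (K0Add.toK0Tr_mk b)).trans (hφ.map_mk_heart (b := b) (Iso.refl _)))
  have h₂ : Function.LeftInverse φ (K0Add.toK0Tr B) := DFunLike.congr_fun h₁
  exact ⟨φ, hφ, (h₂.rightInverse_of_surjective h.toK0Tr_surjective).injective, h₂.surjective⟩

end WeightStructure

end Weights

end

/-! ### Homology of weight complexes and the semi-simple case. -/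

noncomputable section

namespace Weights

section Homology

variable {A : Type u} [Category.{v} A] [Abelian A]

lemma nonempty_homology_iso {K L : CochainComplex A ℤ}
    (e : (HomotopyCategory.quotient A (ComplexShape.up ℤ)).obj K ≅
      (HomotopyCategory.quotient A (ComplexShape.up ℤ)).obj L) (n : ℤ) :
    Nonempty (K.homology n ≅ L.homology n) :=
  ⟨(HomotopyCategory.homologyFunctorFactors A (ComplexShape.up ℤ) n).symm.app K ≪≫
    (HomotopyCategory.homologyFunctor A (ComplexShape.up ℤ) n).mapIso e ≪≫
    (HomotopyCategory.homologyFunctorFactors A (ComplexShape.up ℤ) n).app L⟩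

lemma nonempty_homology_zero_iso {K : CochainComplex A ℤ}
    (hK : ∀ n : ℤ, n ≠ 0 → IsZero (K.X n)) : Nonempty (K.homology 0 ≅ K.X 0) := by
  obtain ⟨e⟩ := nonempty_iso_single hK (Iso.refl _)
  exact ⟨(HomologicalComplex.homologyFunctor A (ComplexShape.up ℤ) 0).mapIso e ≪≫
    HomologicalComplex.singleObjHomologySelfIso _ 0 _⟩

/-- In the exact sequence H⁻¹(Z) → H⁰(K) → H⁰(L) → H⁰(Z) the outer terms vanish. In homological
indexing these are the indices 1 and 0 of the cone. -/
lemma nonempty_homology_iso_of_distTriang {K L Z : CochainComplex A ℤ}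
    {a : (HomotopyCategory.quotient A (ComplexShape.up ℤ)).obj K ⟶
      (HomotopyCategory.quotient A (ComplexShape.up ℤ)).obj L}
    {b : (HomotopyCategory.quotient A (ComplexShape.up ℤ)).obj L ⟶
      (HomotopyCategory.quotient A (ComplexShape.up ℤ)).obj Z}
    {c : (HomotopyCategory.quotient A (ComplexShape.up ℤ)).obj Z ⟶
      ((HomotopyCategory.quotient A (ComplexShape.up ℤ)).obj K)⟦(1 : ℤ)⟧}
    (hT : Triangle.mk a b c ∈ distTriang (HomotopyCategory A (ComplexShape.up ℤ)))
    (h₀ : IsZero (Z.homology 0)) (h₁ : IsZero (Z.homology (-1))) :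
    Nonempty (K.homology 0 ≅ L.homology 0) := by
  let Φ := HomotopyCategory.homologyFunctor A (ComplexShape.up ℤ) 0
  have h₀' : IsZero ((Φ.shift (0 : ℤ)).obj
      ((HomotopyCategory.quotient A (ComplexShape.up ℤ)).obj Z)) :=
    h₀.of_iso ((HomotopyCategory.homologyFunctorFactors A (ComplexShape.up ℤ) 0).app Z)
  have h₁' : IsZero ((Φ.shift (-1 : ℤ)).obj
      ((HomotopyCategory.quotient A (ComplexShape.up ℤ)).obj Z)) :=
    h₁.of_iso ((HomotopyCategory.homologyFunctorFactors A (ComplexShape.up ℤ) (-1)).app Z)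
  have i₁ : Epi ((Φ.shift (0 : ℤ)).map a) :=
    (Φ.homologySequence_epi_shift_map_mor₁_iff _ hT 0).2 (h₀'.eq_of_tgt _ _)
  have i₂ : Mono ((Φ.shift (0 : ℤ)).map a) :=
    (Φ.homologySequence_mono_shift_map_mor₁_iff _ hT (-1) 0 (by lia)).2 (h₁'.eq_of_src _ _)
  have : IsIso ((Φ.shift (0 : ℤ)).map a) := isIso_of_mono_of_epi _
  exact ⟨(HomotopyCategory.homologyFunctorFactors A (ComplexShape.up ℤ) 0).symm.app K ≪≫
    @asIso _ _ _ _ ((Φ.shift (0 : ℤ)).map a) this ≪≫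
    (HomotopyCategory.homologyFunctorFactors A (ComplexShape.up ℤ) 0).app L⟩

lemma HasFiniteSupport.homology {X : CochainComplex A ℤ} (hX : HasFiniteSupport X) :
    {i : ℤ | ¬ IsZero (X.homology i)}.Finite :=
  hX.subset (fun _ hi h => hi (ShortComplex.isZero_homology_of_isZero_X₂ _ h))

namespace IsSemisimpleAbelian

lemma mk_eq_add_cokernel (hA : IsSemisimpleAbelian A) {X Y : A} (f : X ⟶ Y) [Mono f] :
    K0Add.mk Y = K0Add.mk X + K0Add.mk (cokernel f) :=
  K0Add.mk_eq_add_of_splitting (S := ShortComplex.mk f (cokernel.π f) (cokernel.condition f))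
    (hA _ { exact := ShortComplex.exact_cokernel f
            mono_f := inferInstanceAs (Mono f)
            epi_g := inferInstanceAs (Epi (cokernel.π f)) }).some

lemma mk_eq_kernel_add_image (hA : IsSemisimpleAbelian A) {X Y : A} (f : X ⟶ Y) :
    K0Add.mk X = K0Add.mk (kernel f) + K0Add.mk (Abelian.image f) := by
  rw [hA.mk_eq_add_cokernel (kernel.ι f), K0Add.mk_eq_of_iso (Abelian.coimageIsoImage f).symm]

lemma mk_eq_image_add_cokernel (hA : IsSemisimpleAbelian A) {X Y : A} (f : X ⟶ Y) :
    K0Add.mk Y = K0Add.mk (Abelian.image f) + K0Add.mk (cokernel f) :=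
  K0Add.mk_eq_add_of_splitting
    (S := ShortComplex.mk (kernel.ι (cokernel.π f)) (cokernel.π f) (kernel.condition _))
    (hA _ { exact := ShortComplex.exact_kernel (cokernel.π f)
            mono_f := inferInstanceAs (Mono (kernel.ι (cokernel.π f)))
            epi_g := inferInstanceAs (Epi (cokernel.π f)) }).some

/-- Two split sequences in degree i: the term is made of cycles and the outgoing boundaries, the
cycles of incoming boundaries and homology. -/
lemma mk_X_eq (hA : IsSemisimpleAbelian A) (X : CochainComplex A ℤ) (i : ℤ) :
    K0Add.mk (X.X i) = K0Add.mk (Abelian.image (X.toCycles (i - 1) i)) +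
      K0Add.mk (X.homology i) + K0Add.mk (Abelian.image (X.toCycles i (i + 1))) := by
  have e₁ : cokernel (X.toCycles (i - 1) i) ≅ X.homology i :=
    (cokernelIsCokernel _).coconePointUniqueUpToIso (X.homologyIsCokernel (i - 1) i (by simp))
  have e₂ : kernel (X.toCycles i (i + 1)) ≅ X.cycles i :=
    (kernelCompMono (X.toCycles i (i + 1)) (X.iCycles (i + 1))).symm ≪≫
      kernelIsoOfEq (X.toCycles_i i (i + 1)) ≪≫
      (kernelIsKernel _).conePointUniqueUpToIso (X.cyclesIsKernel i (i + 1) (by simp))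
  rw [hA.mk_eq_kernel_add_image (X.toCycles i (i + 1)), K0Add.mk_eq_of_iso e₂,
    hA.mk_eq_image_add_cokernel (X.toCycles (i - 1) i), K0Add.mk_eq_of_iso e₁]

/-- Each boundary object occurs in two adjacent degrees with opposite signs, so the boundaries
telescope. -/
lemma eulerChar_eq_sum_homology (hA : IsSemisimpleAbelian A) {X : CochainComplex A ℤ}
    (hX : HasFiniteSupport X) :
    eulerChar X = ∑ᶠ i : ℤ, (i.negOnePow : ℤ) • K0Add.mk (X.homology i) := by
  let b (i : ℤ) : K0Add A := (i.negOnePow : ℤ) • K0Add.mk (Abelian.image (X.toCycles (i - 1) i))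
  have hb : (Function.support b).Finite := by
    refine (hX.preimage (f := fun i => i - 1) (sub_left_injective (b := (1 : ℤ))).injOn).subset
      (fun i hi h => hi ?_)
    have : IsZero (Abelian.image (X.toCycles (i - 1) i)) :=
      IsZero.of_epi (Abelian.factorThruImage (X.toCycles (i - 1) i)) h
    simp [b, K0Add.mk_eq_zero this]
  have hb' : (Function.support (fun i => b (i + 1))).Finite :=
    hb.preimage (f := fun i => i + 1) (add_left_injective 1).injOn
  have hh : (Function.support
      (fun i : ℤ => (i.negOnePow : ℤ) • K0Add.mk (X.homology i))).Finite :=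
    hX.homology.subset (fun i hi h => hi (by simp [K0Add.mk_eq_zero h]))
  have key (i : ℤ) : (i.negOnePow : ℤ) • K0Add.mk (X.X i) =
      (i.negOnePow : ℤ) • K0Add.mk (X.homology i) + (b i - b (i + 1)) := by
    have hi : b (i + 1) = -((i.negOnePow : ℤ) •
        K0Add.mk (Abelian.image (X.toCycles i (i + 1)))) := by
      dsimp only [b]
      rw [Int.negOnePow_succ, add_sub_cancel_right]
      simp
    rw [hi, hA.mk_X_eq X i]
    simp only [b, smul_add]
    abel
  have hs : ∑ᶠ i, b (i + 1) = ∑ᶠ i, b i := finsum_comp_equiv (Equiv.addRight (1 : ℤ)) (f := b)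
  rw [eulerChar, finsum_congr key, finsum_add_distrib hh
    ((hb.union hb').subset (Function.support_sub _ _)), finsum_sub_distrib hb hb', hs, sub_self,
    add_zero]

end IsSemisimpleAbelian

end Homology

namespace WeightStructure

variable {C : Type u} [Category.{v} C] [HasZeroObject C] [HasShift C ℤ] [Preadditive C]
  [∀ n : ℤ, (shiftFunctor C n).Additive] [Pretriangulated C] [IsTriangulated C]
  {w : WeightStructure C} {B : ObjectProperty C} {hB : B ≤ w.heart}
  {A : Type u₂} [Category.{v₂} A] [Abelian A] {F : B.FullSubcategory ⥤ A} [F.Additive]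

lemma IsPureValue.nonempty_iso {M : C} {H : A} (h : w.IsPureValue hB F M H)
    {X : CochainComplex B.FullSubcategory ℤ} (hX : w.IsModel hB M X) :
    Nonempty (((F.mapHomologicalComplex (ComplexShape.up ℤ)).obj X).homology 0 ≅ H) := by
  obtain ⟨X', hX', ⟨e⟩⟩ := h
  obtain ⟨e'⟩ := hX.unique hX'
  obtain ⟨e''⟩ := nonempty_homology_iso
    ((F.mapHomotopyCategory (ComplexShape.up ℤ)).mapIso e') 0
  exact ⟨e'' ≪≫ e⟩

variable [HasZeroObject B.FullSubcategory]

lemma isPureValue_heart (b : B.FullSubcategory) : w.IsPureValue hB F b.obj (F.obj b) := by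
  obtain ⟨e⟩ := nonempty_homology_zero_iso
    (K := (F.mapHomologicalComplex (ComplexShape.up ℤ)).obj
      ((HomologicalComplex.single B.FullSubcategory (ComplexShape.up ℤ) 0).obj b))
    (fun n hn => F.map_isZero (HomologicalComplex.isZero_single_obj_X _ 0 b n hn))
  exact ⟨_, isModel_single b, ⟨e ≪≫ F.mapIso (HomologicalComplex.singleObjXSelf _ 0 b)⟩⟩

variable [HasBinaryBiproducts B.FullSubcategory]

lemma IsPureValue.nonempty_iso_homology {M : C} {H : A} {i j : ℤ}
    (h : w.IsPureValue hB F (M⟦i⟧) H) (hij : i = j)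
    {X : CochainComplex B.FullSubcategory ℤ} (hX : w.IsModel hB M X) :
    Nonempty (((F.mapHomologicalComplex (ComplexShape.up ℤ)).obj X).homology j ≅ H) := by
  obtain ⟨e⟩ := h.nonempty_iso (hX.shift i)
  let Φ := F.mapHomologicalComplex (ComplexShape.up ℤ)
  let e₁ : (Φ.obj (X⟦i⟧)).homology 0 ≅ ((Φ.obj X)⟦i⟧).homology 0 :=
    (HomologicalComplex.homologyFunctor A (ComplexShape.up ℤ) 0).mapIso ((Φ.commShiftIso i).app X)
  let e₂ : ((Φ.obj X)⟦i⟧).homology 0 ≅ (Φ.obj X).homology j :=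
    (CochainComplex.ShiftSequence.shiftIso A i 0 j (by lia)).app (Φ.obj X)
  exact ⟨e₂.symm ≪≫ e₁.symm ≪≫ e⟩

lemma IsPureValue.nonempty_iso_of_distTriang {W M Z : C} {f : W ⟶ M} {g : M ⟶ Z}
    {k : Z ⟶ W⟦(1 : ℤ)⟧} (hT : Triangle.mk f g k ∈ distTriang C)
    (hZ : ∀ j : ℤ, (j = 0 ∨ j = 1) → ∃ H : A, w.IsPureValue hB F (Z⟦-j⟧) H ∧ IsZero H)
    {HW HM : A} (hW : w.IsPureValue hB F W HW) (hM : w.IsPureValue hB F M HM) :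
    Nonempty (HW ≅ HM) := by
  obtain ⟨XW, hXW, ⟨eW⟩⟩ := hW
  obtain ⟨XM, hXM, ⟨eM⟩⟩ := hM
  obtain ⟨φ, hφ⟩ := IsModel.exists_mappingCone hT hXW hXM
  obtain ⟨a, b, c, hd⟩ := IsModel.exists_distTriang hT hXW hXM hφ
  have h (j k : ℤ) (hj : j = 0 ∨ j = 1) (hk : -j = k) : IsZero (((F.mapHomologicalComplex
      (ComplexShape.up ℤ)).obj (CochainComplex.mappingCone φ)).homology k) := by
    obtain ⟨H, h₁, h₂⟩ := hZ j hj
    obtain ⟨e⟩ := h₁.nonempty_iso_homology hk hφ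
    exact h₂.of_iso e
  obtain ⟨e⟩ := nonempty_homology_iso_of_distTriang
    ((F.mapHomotopyCategory (ComplexShape.up ℤ)).map_distinguished _ hd)
    (h 0 0 (Or.inl rfl) neg_zero) (h 1 (-1) (Or.inr rfl) rfl)
  exact ⟨eW.symm ≪≫ e ≪≫ eM⟩

variable {T : Type u₁} [Category.{v₁} T] [HasZeroObject T] [HasShift T ℤ] [Preadditive T]
  [∀ n : ℤ, (shiftFunctor T n).Additive] [Pretriangulated T] {ι : T ⥤ C}

lemma IsEulerHom.map_mk_of_semisimple {φ : K0Tr T →+ K0Add A} (hφ : w.IsEulerHom hB ι F φ)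
    (hF : w.IsFinite hB ι F) (hA : IsSemisimpleAbelian A) (N : T) {H : ℤ → A}
    (hH : ∀ i : ℤ, w.IsPureValue hB F ((ι.obj N)⟦-i⟧) (H i)) :
    {i : ℤ | ¬ IsZero (H i)}.Finite ∧
      φ (K0Tr.mk N) = ∑ᶠ i : ℤ, (i.negOnePow : ℤ) • K0Add.mk (H i) := by
  obtain ⟨X, hX, hXF⟩ := hF N
  let Y := (F.mapHomologicalComplex (ComplexShape.up ℤ)).obj X
  have e (i : ℤ) : Nonempty (Y.homology (-i) ≅ H i) := (hH i).nonempty_iso_homology rfl hX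
  have hY : HasFiniteSupport Y := hXF
  refine ⟨(hY.homology.preimage (f := fun i => -i) neg_injective.injOn).subset
    (fun i hi h => hi (h.of_iso (e i).some.symm)), ?_⟩
  refine (hφ N X hX hXF).trans ((hA.eulerChar_eq_sum_homology hY).trans ?_)
  -- H^F_i is the cohomology in degree -i, and the sign (-1)^i is unchanged by i ↦ -i.
  rw [← finsum_comp_equiv (Equiv.neg ℤ)]
  exact finsum_congr (fun i => by
    rw [Equiv.neg_apply, Int.negOnePow_neg, K0Add.mk_eq_of_iso (e i).some])

end WeightStructure

end Weights

end

/-! ### Weight-exact functors and objects with pure image. -/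

noncomputable section

namespace Weights

section Shift

variable {C : Type u} [Category.{v} C] [HasShift C ℤ] {D : Type u₃} [Category.{v₃} D]
  [HasShift D ℤ] {G : C ⥤ D} [G.CommShift ℤ]

/-- The differential of a tower complex involves the identification of [1][n] with [n + 1]; this
compatibility is what lets G commute with that differential. -/
lemma map_shiftFunctorAdd'_inv_app {a b c : ℤ} (h : a + b = c) (X : C) :
    G.map ((shiftFunctorAdd' C a b c h).inv.app X) ≫ (G.commShiftIso c).hom.app X =
      (G.commShiftIso b).hom.app (X⟦a⟧) ≫ ((G.commShiftIso a).hom.app X)⟦b⟧' ≫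
        (shiftFunctorAdd' D a b c h).inv.app (G.obj X) := by
  rw [G.commShiftIso_add' h, Functor.CommShift.isoAdd'_hom_app]
  rw [← G.map_comp_assoc, Iso.inv_hom_id_app, CategoryTheory.Functor.map_id]
  exact id_comp _

lemma map_shift_comp_shiftFunctorAdd'_inv_app {a b c : ℤ} (h : a + b = c) {X Y : C}
    (u : X ⟶ Y⟦a⟧) :
    G.map (u⟦b⟧' ≫ (shiftFunctorAdd' C a b c h).inv.app Y) ≫ (G.commShiftIso c).hom.app Y =
      (G.commShiftIso b).hom.app X ≫ (G.map u ≫ (G.commShiftIso a).hom.app Y)⟦b⟧' ≫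
        (shiftFunctorAdd' D a b c h).inv.app (G.obj Y) := by
  have h₁ := G.commShiftIso_hom_naturality u b
  have h₂ := map_shiftFunctorAdd'_inv_app (G := G) h Y
  refine (congrArg (· ≫ _) (G.map_comp _ _)).trans ((assoc _ _ _).trans ?_)
  refine (congrArg (G.map (u⟦b⟧') ≫ ·) h₂).trans ((assoc _ _ _).symm.trans ?_)
  refine (congrArg (· ≫ _) h₁).trans ((assoc _ _ _).trans (congrArg (_ ≫ ·) ?_))
  exact (assoc _ _ _).symm.trans (congrArg (· ≫ _) ((shiftFunctor D b).map_comp _ _).symm)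

end Shift

namespace WeightStructure

variable {C : Type u} [Category.{v} C] [HasZeroObject C] [HasShift C ℤ] [Preadditive C]
  [∀ n : ℤ, (shiftFunctor C n).Additive] [Pretriangulated C] {w : WeightStructure C}
  {D : Type u₃} [Category.{v₃} D] [HasZeroObject D] [HasShift D ℤ] [Preadditive D]
  [∀ n : ℤ, (shiftFunctor D n).Additive] [Pretriangulated D] {v : WeightStructure D}
  {G : C ⥤ D} [G.CommShift ℤ]

namespace WeightExact

lemma isLE (hG : w.WeightExact v G) {X : C} {i : ℤ} (h : w.IsLE i X) : v.IsLE i (G.obj X) :=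
  v.le_of_iso ((G.commShiftIso (-i)).app X) (hG.le _ h)

lemma isGE (hG : w.WeightExact v G) {X : C} {i : ℤ} (h : w.IsGE i X) : v.IsGE i (G.obj X) :=
  v.ge_of_iso ((G.commShiftIso (-i)).app X) (hG.ge _ h)

variable (hG : w.WeightExact v G) [G.IsTriangulated]

/-- The image of a weight Postnikov tower under a weight-exact functor. -/
def mapTower {M : C} (T : w.PostnikovTower M) : v.PostnikovTower (G.obj M) where
  obj n := G.obj (T.obj n)
  toObj n := G.map (T.toObj n)
  isLE n := hG.isLE (T.isLE n)
  isGE n := by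
    obtain ⟨R, g, h, hT, hR⟩ := T.isGE n
    exact ⟨G.obj R, G.map g, G.map h ≫ (G.commShiftIso (1 : ℤ)).hom.app _,
      G.map_distinguished _ hT, hG.isGE hR⟩
  map n := G.map (T.map n)
  comm n := by rw [← G.map_comp, T.comm]
  factor n := G.obj (T.factor n)
  π n := G.map (T.π n)
  δ n := G.map (T.δ n) ≫ (G.commShiftIso (1 : ℤ)).hom.app _
  distinguished n := G.map_distinguished _ (T.distinguished n)

/-- The terms of the complex of the image of a tower. -/
def mapTowerXIso {M : C} (T : w.PostnikovTower M) (n : ℤ) :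
    G.obj (T.X n) ≅ (hG.mapTower T).X n :=
  (G.commShiftIso n).app (T.factor n)

lemma map_d_mapTowerXIso {M : C} (T : w.PostnikovTower M) (n : ℤ) :
    G.map (T.d n) ≫ (hG.mapTowerXIso T (n + 1)).hom =
      (hG.mapTowerXIso T n).hom ≫ (hG.mapTower T).d n := by
  let u := T.δ n ≫ (T.π (n + 1))⟦(1 : ℤ)⟧'
  have h : (hG.mapTower T).d n = (G.map u ≫ (G.commShiftIso (1 : ℤ)).hom.app _)⟦n⟧' ≫
      (shiftFunctorAdd' D 1 n (n + 1) (add_comm 1 n)).inv.app (G.obj (T.factor (n + 1))) := by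
    change ((G.map (T.δ n) ≫ (G.commShiftIso (1 : ℤ)).hom.app _) ≫
      (G.map (T.π (n + 1)))⟦(1 : ℤ)⟧')⟦n⟧' ≫ _ = _
    rw [assoc, ← G.commShiftIso_hom_naturality, ← G.map_comp_assoc]
    rfl
  rw [h]
  exact map_shift_comp_shiftFunctorAdd'_inv_app (add_comm 1 n) u

lemma isWeightComplex {M : C} {K : CochainComplex w.Heart ℤ} (h : w.IsWeightComplex M K)
    [hG.heartFunctor.Additive] :
    v.IsWeightComplex (G.obj M)
      ((hG.heartFunctor.mapHomologicalComplex (ComplexShape.up ℤ)).obj K) := by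
  obtain ⟨T, e, he⟩ := h
  refine ⟨hG.mapTower T, fun n => G.mapIso (e n) ≪≫ hG.mapTowerXIso T n, fun n => ?_⟩
  change G.map (w.heart.ι.map (K.d n (n + 1))) ≫ G.map (e (n + 1)).hom ≫
    (hG.mapTowerXIso T (n + 1)).hom = (G.map (e n).hom ≫ (hG.mapTowerXIso T n).hom) ≫ _
  rw [assoc, ← hG.map_d_mapTowerXIso, ← G.map_comp_assoc, ← G.map_comp_assoc, he]

instance additive_heartFunctor : hG.heartFunctor.Additive where
  map_add {X Y f g} := by
    ext
    exact G.map_add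

lemma isModel {M : C} {X : CochainComplex w.Heart ℤ} (h : w.IsModel le_rfl M X) :
    v.IsModel le_rfl (G.obj M)
      ((hG.heartFunctor.mapHomologicalComplex (ComplexShape.up ℤ)).obj X) := by
  obtain ⟨K, hK, ⟨e⟩⟩ := h
  exact ⟨_, hG.isWeightComplex hK, ⟨hG.heartFunctor.mapHomotopyEquiv e⟩⟩

end WeightExact

variable [IsTriangulated C] [IsTriangulated D] [G.IsTriangulated]

/-- G(N[-j]) lies in the heart of v, so its weight complex is represented both by the image of a
complex for N[-j] and by one object in degree 0. Applying F' to the two shows that the Euler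
characteristic of F on N[-j] is the class of its only possibly nonzero homology. -/
lemma IsEulerHom.map_mk_of_weightExact {A : Type u₂} [Category.{v₂} A] [Abelian A]
    (hG : w.WeightExact v G) {F' : v.Heart ⥤ A} [F'.Additive] {F : w.Heart ⥤ A} [F.Additive]
    (e : F ≅ hG.heartFunctor ⋙ F') (hw : StronglyGenerates w.heart)
    {φ : K0Tr C →+ K0Add A} (hφ : w.IsEulerHom le_rfl (𝟭 C) F φ) {N : C} {j : ℤ}
    (hN : v.IsEQ j (G.obj N)) {H : A} (hH : w.IsPureValue le_rfl F (N⟦-j⟧) H) :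
    φ (K0Tr.mk N) = (j.negOnePow : ℤ) • K0Add.mk H := by
  -- The model is chosen with finite support over Hw itself, so its images under both F and HG have
  -- finite support.
  obtain ⟨X, hX, hXf⟩ := isFinite_of_stronglyGenerates (hB := le_refl w.heart) hw (N⟦-j⟧)
  let HX := (hG.heartFunctor.mapHomologicalComplex (ComplexShape.up ℤ)).obj X
  have hXf' : HasFiniteSupport X := hXf
  have hHX : v.IsModel le_rfl ((G.obj N)⟦-j⟧) HX :=
    (hG.isModel hX).of_iso_obj ((G.commShiftIso (-j)).app N)
  let P : v.Heart := ⟨(G.obj N)⟦-j⟧, hN⟩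
  let S := (HomologicalComplex.single v.Heart (ComplexShape.up ℤ) 0).obj P
  have hS : v.IsModel le_rfl ((G.obj N)⟦-j⟧) S := isModel_single P
  let eX : (F.mapHomologicalComplex (ComplexShape.up ℤ)).obj X ≅
      (F'.mapHomologicalComplex (ComplexShape.up ℤ)).obj HX :=
    (NatIso.mapHomologicalComplex e (ComplexShape.up ℤ)).app X
  have h₀ (n : ℤ) (hn : n ≠ 0) :
      IsZero (((F'.mapHomologicalComplex (ComplexShape.up ℤ)).obj S).X n) :=
    F'.map_isZero (HomologicalComplex.isZero_single_obj_X _ 0 P n hn)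
  obtain ⟨e₁⟩ := hH.nonempty_iso hX
  have hH' : v.IsPureValue le_rfl F' ((G.obj N)⟦-j⟧) H :=
    ⟨HX, hHX, ⟨(HomologicalComplex.homologyFunctor A (ComplexShape.up ℤ) 0).mapIso eX.symm ≪≫ e₁⟩⟩
  obtain ⟨e₂⟩ := hH'.nonempty_iso hS
  obtain ⟨e₃⟩ := nonempty_homology_zero_iso h₀
  have h₁ : φ (K0Tr.mk (N⟦-j⟧)) = K0Add.mk H := by
    rw [hφ _ X hX (hXf'.map F), K0Add.mk_eq_of_iso (e₂.symm ≪≫ e₃), ← eulerChar_of_isZero h₀]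
    exact (eulerChar_eq_of_iso (hXf'.map F) ((hXf'.map F).of_iso eX)
      ((HomotopyCategory.quotient _ _).mapIso eX)).trans
      (hHX.eulerChar_eq hS ((hXf'.map F).of_iso eX) (hasFiniteSupport_of_isZero h₀))
  rw [← h₁, K0Tr.mk_shift, map_zsmul, smul_smul, Int.negOnePow_neg, ← Units.val_mul,
    ← Int.negOnePow_add, Int.negOnePow_even _ ⟨j, rfl⟩, Units.val_one, one_smul]

end WeightStructure

end Weights

end

/-! ### Morphisms to or from an object of the heart. -/

noncomputable section

namespace Weights

namespace WeightStructure

variable {C : Type u} [Category.{v} C] [HasZeroObject C] [HasShift C ℤ] [Preadditive C]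
  [∀ n : ℤ, (shiftFunctor C n).Additive] [Pretriangulated C] [IsTriangulated C]
  {w : WeightStructure C} {A : Type u₂} [Category.{v₂} A] [Abelian A]
  {F : w.Heart ⥤ A} [F.Additive]
  {T : Type u₁} [Category.{v₁} T] [HasZeroObject T] [HasShift T ℤ] [Preadditive T]
  [∀ n : ℤ, (shiftFunctor T n).Additive] [Pretriangulated T] {ι : T ⥤ C}

lemma IsEulerHom.map_mk_of_isConeOfHom {φ : K0Tr T →+ K0Add A}
    (hφ : w.IsEulerHom le_rfl ι F φ) {N N' Z : T} (hN' : w.heart (ι.obj N'))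
    (h : IsConeOfHom N' N Z ∨ IsConeOfHom N N' Z) (hZ : φ (K0Tr.mk Z) = 0) :
    φ (K0Tr.mk N) = K0Add.mk (F.obj ⟨ι.obj N', hN'⟩) := by
  rw [← hφ.map_mk_heart (M := N') (b := ⟨ι.obj N', hN'⟩) (Iso.refl _)]
  rcases h with ⟨f, g, k, hT⟩ | ⟨f, g, k, hT⟩
  · simpa [hZ] using congrArg φ (K0Tr.mk_eq_add hT)
  · simpa [hZ] using (congrArg φ (K0Tr.mk_eq_add hT)).symm

/-- Vanishing of the homology of the cone in indices 0 and 1 identifies H^F of the two ends of h,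
whichever its direction, and H^F(N') = F(N'). -/
lemma IsPureValue.nonempty_iso_of_isConeOfHom [ι.CommShift ℤ] [ι.IsTriangulated] {N N' Z : T}
    (hN' : w.heart (ι.obj N')) (h : IsConeOfHom N' N Z ∨ IsConeOfHom N N' Z)
    (hZ : ∀ j : ℤ, (j = 0 ∨ j = 1) →
      ∃ H : A, w.IsPureValue le_rfl F ((ι.obj Z)⟦-j⟧) H ∧ IsZero H)
    {H : A} (hH : w.IsPureValue le_rfl F (ι.obj N) H) :
    Nonempty (F.obj ⟨ι.obj N', hN'⟩ ≅ H) := by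
  have hP : w.IsPureValue le_rfl F (ι.obj N') (F.obj ⟨ι.obj N', hN'⟩) :=
    isPureValue_heart (⟨ι.obj N', hN'⟩ : w.Heart)
  rcases h with ⟨f, g, k, hT⟩ | ⟨f, g, k, hT⟩
  · exact IsPureValue.nonempty_iso_of_distTriang (ι.map_distinguished _ hT) hZ hP hH
  · exact (IsPureValue.nonempty_iso_of_distTriang (ι.map_distinguished _ hT) hZ hH hP).map Iso.symm

end WeightStructure

end Weights

end

theorem theorem3p2p4
    {C : Type u} [Category.{v} C] [HasZeroObject C] [HasShift C ℤ] [Preadditive C]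
    [∀ n : ℤ, (shiftFunctor C n).Additive] [Pretriangulated C] [IsTriangulated C]
    (w : Weights.WeightStructure C)
    (C' : ObjectProperty C) [C'.IsTriangulated]
    (B : ObjectProperty C) (hB : B ≤ w.heart)
    [HasZeroObject B.FullSubcategory] [HasBinaryBiproducts B.FullSubcategory] :
    (∀ (A : Type u₂) [Category.{v₂} A] [Preadditive A] [HasZeroObject A] [HasBinaryBiproducts A]
      (F : B.FullSubcategory ⥤ A) [F.Additive], w.IsFinite hB C'.ι F →
      ∃! φ : Weights.K0Tr C'.FullSubcategory →+ Weights.K0Add A, w.IsEulerHom hB C'.ι F φ) ∧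
    (∀ (A : Type u₂) [Category.{v₂} A] [Abelian A] (F : w.Heart ⥤ A) [F.Additive]
      (φ : Weights.K0Tr C'.FullSubcategory →+ Weights.K0Add A) (N N' Z : C'.FullSubcategory)
      (hN' : w.heart N'.obj),
      w.heart ≤ C' → w.IsFinite le_rfl C'.ι F → w.IsEulerHom le_rfl C'.ι F φ →
      (Weights.WeightStructure.IsConeOfHom N' N Z ∨ Weights.WeightStructure.IsConeOfHom N N' Z) →
      φ (Weights.K0Tr.mk Z) = 0 →
      φ (Weights.K0Tr.mk N) = Weights.K0Add.mk (F.obj ⟨N'.obj, hN'⟩) ∧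
      ((∀ j : ℤ, (j = 0 ∨ j = 1) →
          ∃ H : A, w.IsPureValue le_rfl F (Z.obj⟦-j⟧) H ∧ IsZero H) →
        ∀ H : A, w.IsPureValue le_rfl F N.obj H →
          φ (Weights.K0Tr.mk N) = Weights.K0Add.mk H)) ∧
    (∀ (A : Type u₂) [Category.{v₂} A] [Abelian A] (F : B.FullSubcategory ⥤ A) [F.Additive]
      (φ : Weights.K0Tr C'.FullSubcategory →+ Weights.K0Add A) (N : C'.FullSubcategory),
      Weights.IsSemisimpleAbelian A → w.IsFinite hB C'.ι F → w.IsEulerHom hB C'.ι F φ →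
      ∀ H : ℤ → A, (∀ i : ℤ, w.IsPureValue hB F (N.obj⟦-i⟧) (H i)) →
        {i : ℤ | ¬ IsZero (H i)}.Finite ∧
        φ (Weights.K0Tr.mk N) = ∑ᶠ i : ℤ, (i.negOnePow : ℤ) • Weights.K0Add.mk (H i)) ∧
    (Weights.StronglyGenerates B →
      w.IsFinite hB (𝟭 C) (𝟭 B.FullSubcategory) ∧
      ∃ φ : Weights.K0Tr C →+ Weights.K0Add B.FullSubcategory,
        w.IsEulerHom hB (𝟭 C) (𝟭 B.FullSubcategory) φ ∧ Function.Bijective φ) ∧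
    ((Weights.StronglyGenerates B ∨ w.IsBounded) →
      w.IsFinite le_rfl (𝟭 C) (𝟭 w.Heart) ∧
      ∃ φ : Weights.K0Tr C →+ Weights.K0Add w.Heart,
        w.IsEulerHom le_rfl (𝟭 C) (𝟭 w.Heart) φ ∧ Function.Bijective φ) ∧
    (∀ (A : Type u₂) [Category.{v₂} A] [Abelian A]
      (D : Type u₃) [Category.{v₃} D] [HasZeroObject D] [HasShift D ℤ] [Preadditive D]
      [∀ n : ℤ, (shiftFunctor D n).Additive] [Pretriangulated D] [IsTriangulated D]
      (v : Weights.WeightStructure D) (G : C ⥤ D) [G.CommShift ℤ] [G.IsTriangulated]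
      (hG : w.WeightExact v G) (F' : v.Heart ⥤ A) [F'.Additive] (F : w.Heart ⥤ A) [F.Additive]
      (φ : Weights.K0Tr C →+ Weights.K0Add A) (N : C) (j : ℤ),
      Weights.StronglyGenerates w.heart → Nonempty (F ≅ hG.heartFunctor ⋙ F') →
      w.IsEulerHom le_rfl (𝟭 C) F φ → v.IsEQ j (G.obj N) →
      ∀ H : A, w.IsPureValue le_rfl F (N⟦-j⟧) H →
        φ (Weights.K0Tr.mk N) = (j.negOnePow : ℤ) • Weights.K0Add.mk H) := by
  refine ⟨?_, ?_, ?_, ?_, ?_, ?_⟩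
  · intro A _ _ _ _ F _ hF
    exact hF.existsUnique_isEulerHom
  · intro A _ _ F _ φ N N' Z hN' _ _ hφ hc hZ
    have h := hφ.map_mk_of_isConeOfHom hN' hc hZ
    refine ⟨h, fun hZ' H hH => h.trans ?_⟩
    obtain ⟨e⟩ := Weights.WeightStructure.IsPureValue.nonempty_iso_of_isConeOfHom
      (ι := C'.ι) hN' hc hZ' hH
    exact Weights.K0Add.mk_eq_of_iso e
  · intro A _ _ F _ φ N hA hF hφ H hH
    exact hφ.map_mk_of_semisimple hF hA N hH
  · intro h
    exact ⟨Weights.WeightStructure.isFinite_of_stronglyGenerates h,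
      Weights.WeightStructure.exists_bijective_isEulerHom h⟩
  · intro h
    have h' : Weights.StronglyGenerates w.heart := h.elim (fun h => h.mono hB)
      Weights.WeightStructure.IsBounded.stronglyGenerates_heart
    exact ⟨Weights.WeightStructure.isFinite_of_stronglyGenerates h',
      Weights.WeightStructure.exists_bijective_isEulerHom h'⟩
  · intro A _ _ D _ _ _ _ _ _ _ v G _ _ hG F' _ F _ φ N j hw ⟨e⟩ hφ hN H hH
    exact hφ.map_mk_of_weightExact hG e hw hN hH
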